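/- Let $n\ge 1$, let $e_1,\dots,e_n$ be the standard basis of $\mathbb R^n$, and consider the classical root systems with positive roots $A_{n-1}^+=\{e_i-e_j : i<j\}$, $B_n^+=\{e_i\pm e_j : i<j\}\cup\{e_i\}$, $C_n^+=\{e_i\pm e_j : i<j\}\cup\{2e_i\}$, $D_n^+=\{e_i\pm e_j : i<j\}$, where $1\le i,j\le n$. For $\Phi\in\{A_{n-1},B_n,C_n,D_n\}$ the standard and the integral Coxeter permutahedron are the Minkowski sums $$\Pi(\Phi)=\sum_{\alpha\in\Phi^+}\left[-\tfrac{\alpha}{2},\tfrac{\alpha}{2}\right],\qquad \Pi^{\mathbb Z}(\Phi)=\sum_{\alpha\in\Phi^+}[0,\alpha]$$ in $\mathbb R^n$. For a polytope $P\subset\mathbb R^n$ and a positive integer $t$ let $\mathrm{ehr}_P(t)=|tP\cap\mathbb Z^n|$. Consider signed graphs on $[n]=\{1,\dots,n\}$ in which any two distinct vertices may be joined by a positive edge, a negative edge, or both, and every vertex may carry at most one halfedge and at most one negative loop. A $\Phi$-graph is such a graph with only positive edges, no halfedges and no loops if $\Phi=A_{n-1}$; without loops if $\Phi=B_n$; without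 halfedges if $\Phi=C_n$; without halfedges and loops if $\Phi=D_n$. Two parallel edges of opposite signs form a cycle (of length 2); loops and halfedges are not counted as cycles. A cycle is unbalanced if it has an odd number of negative edges. A connected signed graph is a tree if it has no cycles, loops or halfedges; a halfedge-tree if it has no cycles or loops and exactly one halfedge; a loop-tree if it has no cycles or halfedges and exactly one loop; a pseudotree if it has no loops or halfedges and contains exactly one cycle, which is unbalanced. A $\Phi$-forest is a $\Phi$-graph each of whose connected components is a tree, a halfedge-tree, a loop-tree or a pseudotree; $\mathrm{tc}(G)$, $\mathrm{lc}(G)$, $\mathrm{pc}(G)$ denote the numbers of components of $G$ that are trees, loop-trees, pseudotrees. Let $\mathcal F(\Phi)$ be the set of $\Phi$-forests on $[n]$, and $\mathcal E(\Phi)\subseteq\mathcal F(\Phi)$ the set of those in which every tree component has an even number of vertices. **Theorem 4.3.** 1. For every $\Phi\in\{A_{n-1},B_n,C_n,D_n\}$, the Ehrhart polynomial of the integral Coxeter permutahedron is $$\mathrm{ehr}_{\Pi^{\mathbb Z}(\Phi)}(t)=\sum_{G\in\mathcal F(\Phi)}2^{\mathrm{pc}(G)+\mathrm{lc}(G)}\,t^{\,n-\mathrm{tc}(G)}.$$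 2. For $\Phi=A_{n-1}$ with $n\geq 2$ even, and for $\Phi=B_n$ with $n\ge 1$, the Ehrhart quasipolynomial of the standard Coxeter permutahedron has (minimal) period $2$ and is $$\mathrm{ehr}_{\Pi(\Phi)}(t)=\begin{cases}\displaystyle\sum_{G\in\mathcal F(\Phi)}2^{\mathrm{pc}(G)}\,t^{\,n-\mathrm{tc}(G)}&\text{if } t \text{ is even},\\[2ex]\displaystyle\sum_{G\in\mathcal E(\Phi)}2^{\mathrm{pc}(G)}\,t^{\,n-\mathrm{tc}(G)}&\text{if } t \text{ is odd}.\end{cases}$$ For $\Phi=A_{n-1}$ with $n\ge 1$ odd, and for $\Phi=C_n$ or $\Phi=D_n$ with $n\ge 1$, one has $\mathrm{ehr}_{\Pi(\Phi)}(t)=\mathrm{ehr}_{\Pi^{\mathbb Z}(\Phi)}(t)$ for every positive integer $t$. -/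

import Mathlib

open scoped Pointwise

noncomputable section

/-! ### Ehrhart theory in `ℝⁿ` with respect to the lattice `ℤⁿ` -/

/-- The lattice point count `|tP ∩ ℤⁿ|`, as an extended natural number. -/
def ehr {n : ℕ} (P : Set (Fin n → ℝ)) (t : ℕ) : ℕ∞ :=
  {x : Fin n → ℝ | x ∈ (t : ℝ) • P ∧ ∀ i, ∃ z : ℤ, x i = (z : ℝ)}.encard

/-- `f` is the Ehrhart polynomial of `P`: for every positive integer `t` the set `tP ∩ ℤⁿ`
is finite and has exactly `f(t)` elements. -/
def IsEhrhartPolynomial {n : ℕ} (P : Set (Fin n → ℝ)) (f : Polynomial ℚ) : Prop :=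
  ∀ t : ℕ, 0 < t → ∃ m : ℕ, ehr P t = (m : ℕ∞) ∧ (m : ℚ) = f.eval (t : ℚ)

/-- The quasipolynomial `t ↦ ∑ i, cᵢ(t) tⁱ`, recorded by the polynomials
`q t = ∑ i, cᵢ(t) Xⁱ`, is the Ehrhart quasipolynomial of `P`, and it has period `p`, meaning
that `p` is the minimal common period of its coefficient functions `cᵢ : ℤ → ℚ`. -/
structure IsEhrhartQuasipolynomial {n : ℕ} (P : Set (Fin n → ℝ)) (p : ℕ)
    (q : ℤ → Polynomial ℚ) : Prop where
  period : IsLeast {r : ℕ | 0 < r ∧ Function.Periodic q (r : ℤ)} p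
  count : ∀ t : ℕ, 0 < t → ∃ m : ℕ, ehr P t = (m : ℕ∞) ∧ (m : ℚ) = (q (t : ℤ)).eval (t : ℚ)

/-! ### Classical root systems and their Coxeter permutahedra -/

/-- The four classical types. In dimension `n` they stand for the root systems
`A_{n-1}`, `B_n`, `C_n`, `D_n`, all of them living in `ℝⁿ`. -/
inductive ClassicalType where
  | A
  | B
  | C
  | D

/-- The standard basis vector `e_i` of `ℝⁿ`. -/
def stdVec {n : ℕ} (i : Fin n) : Fin n → ℝ := Pi.single i 1

/-- The vectors `e_i - e_j` with `i < j`. -/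
def rootsMinus (n : ℕ) : Finset (Fin n → ℝ) :=
  (Finset.univ.filter fun p : Fin n × Fin n => p.1 < p.2).image
    fun p => stdVec p.1 - stdVec p.2

/-- The vectors `e_i + e_j` with `i < j`. -/
def rootsPlus (n : ℕ) : Finset (Fin n → ℝ) :=
  (Finset.univ.filter fun p : Fin n × Fin n => p.1 < p.2).image
    fun p => stdVec p.1 + stdVec p.2

/-- The vectors `e_i`. -/
def rootsShort (n : ℕ) : Finset (Fin n → ℝ) :=
  Finset.univ.image fun i : Fin n => stdVec i

/-- The vectors `2 e_i`. -/
def rootsLong (n : ℕ) : Finset (Fin n → ℝ) :=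
  Finset.univ.image fun i : Fin n => (2 : ℝ) • stdVec i

/-- The positive roots of `A_{n-1}`, `B_n`, `C_n`, `D_n`. -/
def posRoots (n : ℕ) : ClassicalType → Finset (Fin n → ℝ)
  | .A => rootsMinus n
  | .B => rootsMinus n ∪ rootsPlus n ∪ rootsShort n
  | .C => rootsMinus n ∪ rootsPlus n ∪ rootsLong n
  | .D => rootsMinus n ∪ rootsPlus n

/-- The standard Coxeter permutahedron, the Minkowski sum of the segments `[-α/2, α/2]`
over the positive roots `α`. -/
def standardPermutahedron (Φ : ClassicalType) (n : ℕ) : Set (Fin n → ℝ) :=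
  ∑ α ∈ posRoots n Φ, segment ℝ (-((1 / 2 : ℝ) • α)) ((1 / 2 : ℝ) • α)

/-- The integral Coxeter permutahedron, the Minkowski sum of the segments `[0, α]`
over the positive roots `α`. -/
def integralPermutahedron (Φ : ClassicalType) (n : ℕ) : Set (Fin n → ℝ) :=
  ∑ α ∈ posRoots n Φ, segment ℝ 0 α

/-! ### Signed graphs -/

/-- A signed graph on the vertex set `V` without loose edges, without repeated signed edges and
without positive loops. Each pair of distinct vertices may be joined by a positive edge, by a
negative edge, or by both. -/
@[ext]
structure SignedGraph (V : Type*) where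
  /-- the positive edges -/
  pos : SimpleGraph V
  /-- the negative edges -/
  neg : SimpleGraph V
  /-- the vertices carrying a halfedge -/
  half : Set V
  /-- the vertices carrying a (negative) loop -/
  loop : Set V

namespace SignedGraph

variable {V : Type*}

instance [Finite V] : Finite (SignedGraph V) :=
  Finite.of_injective (fun G : SignedGraph V => (G.pos, G.neg, G.half, G.loop)) (by
    intro G H h
    simp only [Prod.mk.injEq] at h
    exact SignedGraph.ext h.1 h.2.1 h.2.2.1 h.2.2.2)

instance [Finite V] : Fintype (SignedGraph V) := Fintype.ofFinite _

/-- The simple graph recording which distinct vertices are joined by some edge. -/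
def underlying (G : SignedGraph V) : SimpleGraph V := G.pos ⊔ G.neg

/-- The signed graph is connected (in particular it has a vertex). -/
def Connected (G : SignedGraph V) : Prop := G.underlying.Connected

/-- The set of edges joining distinct vertices, each with its sign `1` or `-1`. -/
def edges (G : SignedGraph V) : Set (Sym2 V × ℤˣ) :=
  {e | (e.1 ∈ G.pos.edgeSet ∧ e.2 = 1) ∨ (e.1 ∈ G.neg.edgeSet ∧ e.2 = -1)}

/-- `C` is the edge set of a cycle of `G`, running through `m ≥ 2` distinct vertices `v 0, v 1, …`
in cyclic order and using distinct signed edges. For `m = 2` the cycle consists of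
two parallel edges of opposite signs. -/
def IsCycle (G : SignedGraph V) (C : Set (Sym2 V × ℤˣ)) : Prop :=
  ∃ (m : ℕ) (v : ZMod m → V) (s : ZMod m → ℤˣ), 2 ≤ m ∧ Function.Injective v ∧
    Function.Injective (fun i => (s(v i, v (i + 1)), s i)) ∧
    (∀ i, (s(v i, v (i + 1)), s i) ∈ G.edges) ∧
    C = Set.range fun i => (s(v i, v (i + 1)), s i)

/-- The cycle with edge set `C` has an even number of negative edges. -/
def IsBalancedCycle (C : Set (Sym2 V × ℤˣ)) : Prop := Even {e ∈ C | e.2 = -1}.ncard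

/-- Signed trees. -/
def IsTree (G : SignedGraph V) : Prop :=
  G.Connected ∧ (∀ C, ¬ G.IsCycle C) ∧ G.half = ∅ ∧ G.loop = ∅

/-- Signed halfedge-trees. -/
def IsHalfedgeTree (G : SignedGraph V) : Prop :=
  G.Connected ∧ (∀ C, ¬ G.IsCycle C) ∧ (∃! v, v ∈ G.half) ∧ G.loop = ∅

/-- Signed loop-trees. -/
def IsLoopTree (G : SignedGraph V) : Prop :=
  G.Connected ∧ (∀ C, ¬ G.IsCycle C) ∧ G.half = ∅ ∧ ∃! v, v ∈ G.loop

/-- Signed pseudotrees: connected, no halfedges, no loops, and a single cycle, which is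
unbalanced. -/
def IsPseudotree (G : SignedGraph V) : Prop :=
  G.Connected ∧ (∃ C, G.IsCycle C ∧ ¬ IsBalancedCycle C ∧ ∀ C', G.IsCycle C' → C' = C) ∧
    G.half = ∅ ∧ G.loop = ∅

/-- The signed graph induced on a set of vertices. -/
def induce (G : SignedGraph V) (S : Set V) : SignedGraph S where
  pos := G.pos.induce S
  neg := G.neg.induce S
  half := {v | (v : V) ∈ G.half}
  loop := {v | (v : V) ∈ G.loop}

/-- A connected component of `G`, as a signed graph on its own vertex set. -/
def component (G : SignedGraph V) (c : G.underlying.ConnectedComponent) : SignedGraph c.supp :=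
  G.induce c.supp

/-- Signed pseudoforests. -/
def IsPseudoforest (G : SignedGraph V) : Prop :=
  ∀ c, (G.component c).IsTree ∨ (G.component c).IsHalfedgeTree ∨
    (G.component c).IsLoopTree ∨ (G.component c).IsPseudotree

/-- The number of tree components. -/
def tc (G : SignedGraph V) : ℕ := {c | (G.component c).IsTree}.ncard

/-- The number of loop-tree components. -/
def lc (G : SignedGraph V) : ℕ := {c | (G.component c).IsLoopTree}.ncard

/-- The number of pseudotree components. -/
def pc (G : SignedGraph V) : ℕ := {c | (G.component c).IsPseudotree}.ncard

/-- The `Φ`-graphs, which encode the subsets of the positive roots: a positive edge `ij` stands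
for `±(e_i - e_j)`, a negative edge `ij` for `e_i + e_j`, a halfedge at `j` for `e_j` and a
loop at `j` for `2 e_j`. -/
def IsGraphOfType (G : SignedGraph V) : ClassicalType → Prop
  | .A => G.neg = ⊥ ∧ G.half = ∅ ∧ G.loop = ∅
  | .B => G.loop = ∅
  | .C => G.half = ∅
  | .D => G.half = ∅ ∧ G.loop = ∅

end SignedGraph

open Classical in
/-- The set of `Φ`-forests on `n` vertices. -/
def forests (Φ : ClassicalType) (n : ℕ) : Finset (SignedGraph (Fin n)) :=
  Finset.univ.filter fun G => G.IsGraphOfType Φ ∧ G.IsPseudoforest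

open Classical in
/-- The set of `Φ`-forests on `n` vertices all of whose tree components have an even number of
vertices. -/
def evenForests (Φ : ClassicalType) (n : ℕ) : Finset (SignedGraph (Fin n)) :=
  (forests Φ n).filter fun G => ∀ c, (G.component c).IsTree → Even c.supp.ncard

/-- The number of tree components never exceeds the number of vertices, so the exponent
`n - tc(G)` is an honest difference. -/
theorem SignedGraph.tc_le {n : ℕ} (G : SignedGraph (Fin n)) : G.tc ≤ n := by
  have h1 : G.tc ≤ Nat.card G.underlying.ConnectedComponent := by
    rw [← Set.ncard_univ]
    exact Set.ncard_le_ncard (Set.subset_univ _) (Set.toFinite _)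
  have h2 : Nat.card G.underlying.ConnectedComponent ≤ Nat.card (Fin n) :=
    Nat.card_le_card_of_surjective G.underlying.connectedComponentMk
      (fun c => c.exists_rep)
  simpa using h1.trans h2

end

/-! ### Lattice points of zonotopes by deletion and contraction -/

/-! The count rests on deletion and contraction for lattice zonotopes. If a compact convex set `P`
meets a line parallel to a lattice vector `u`, then adding the segment `[0, u]` lengthens the
intersection by a half-open interval of length one, which contains exactly one element of each coset
of `ℤu` on that line. So the lattice points gained in passing from `P` to `P + [0, u]` correspond to
the lattice points of `P + ℝu` modulo `ℤu`. Iterating (`encard_hits_zonotope`), the lattice points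
of `w + ∑ [0, uᵢ]` are counted by a sum over the linearly independent sets `S` of generators. The
term of `S` is the number of lattice points of the flat `w + span S` modulo the lattice `ℤS`: zero
if the flat misses the lattice, and otherwise the index of `ℤS` in `ℤⁿ ∩ span S`.

For a dilated Coxeter permutahedron the generators are `t` times the roots, and sets of roots are
signed graphs; an edge `ij` of sign `σ` with `i < j` is `e_i - σ e_j`. Within a component all basis
vectors agree up to sign modulo the lattice of the graph. Membership in that lattice is therefore
decided by one signed sum per component: it must vanish if the component is balanced, be even if it
is unbalanced without halfedges, and is arbitrary otherwise (`IsSigning.mem_lattice_iff`). Hence the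
rank is `n` minus the number of balanced components (`finrank_realSpan`), and the index in `ℤⁿ ∩
span` is a power of two (`relIndex_lattice`). Comparing the rank with the number of edges, halfedges
and loops, independence means that every component is a tree, halfedge-tree, loop-tree or pseudotree
(`linearIndepOn_cells_iff`). The dilation contributes the index `t ^ (n - tc)`.

The standard permutahedron is the integral one translated by minus half the sum of the roots. The
coordinates of that sum have the parity of `n - 1` in type `A`, are odd in type `B` and even in
types `C` and `D`. When `t` times the sum is even, the translation is by a lattice vector. When all
its coordinates are odd, the flat of a forest contains a lattice point exactly if every tree
component has an even number of vertices (`exists_latticeCast_sub_mem_realSpan_iff`). -/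

section Hits

variable {Λ V : Type*} [AddCommGroup Λ] [AddCommGroup V]

/-- The classes modulo `L` of the elements of `Λ` that `c` maps into `P`. -/
def hits (c : Λ →+ V) (L : AddSubgroup Λ) (P : Set V) : Set (Λ ⧸ L) :=
  (fun x : Λ => (x : Λ ⧸ L)) '' (c ⁻¹' P)

theorem mem_hits {c : Λ →+ V} {L : AddSubgroup Λ} {P : Set V} {x : Λ} (hP : ∀ l ∈ L, ∀ p ∈ P, p + c l ∈ P) :
    (x : Λ ⧸ L) ∈ hits c L P ↔ c x ∈ P := by
  constructor
  · rintro ⟨y, hy, hyx⟩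
    have h := hP _ (QuotientAddGroup.eq.mp hyx) _ hy
    simpa using h
  · intro h
    exact ⟨x, h, rfl⟩

variable [Module ℝ V]

/-- Adding the segment `[0, v]` to a set that meets the line `a + ℝ v` in a compact interval
extends that interval by a half-open interval of length one. -/
theorem exists_halfOpen_of_line {P : Set V} {v a : V} (hconv : Convex ℝ P)
    (hclosed : IsClosed {r : ℝ | a + r • v ∈ P}) (hbdd : BddAbove {r : ℝ | a + r • v ∈ P})
    (hne : {r : ℝ | a + r • v ∈ P}.Nonempty) :
    ∃ b : ℝ, ∀ r : ℝ, (a + r • v ∈ P + segment ℝ 0 v ∧ a + r • v ∉ P) ↔ b < r ∧ r ≤ b + 1 := by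
  set I := {r : ℝ | a + r • v ∈ P} with hI
  have hmem : sSup I ∈ I := hclosed.csSup_mem hne hbdd
  have hIconv : Convex ℝ I := by
    intro r hr s hs x y hx hy hxy
    have := hconv hr hs hx hy hxy
    have h2 : x • (a + r • v) + y • (a + s • v) = a + (x • r + y • s) • v := by
      have : a = (x + y) • a := by rw [hxy, one_smul]
      conv_rhs => rw [this]
      simp only [smul_eq_mul]
      module
    rwa [h2] at this
  have hord := hIconv.ordConnected
  have hseg : ∀ r : ℝ, a + r • v ∈ P + segment ℝ 0 v ↔ ∃ s : ℝ, 0 ≤ s ∧ s ≤ 1 ∧ r - s ∈ I := by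
    intro r
    rw [segment_eq_image, Set.mem_add]
    constructor
    · rintro ⟨p, hp, q, ⟨s, hs, rfl⟩, h⟩
      refine ⟨s, hs.1, hs.2, ?_⟩
      have : p = a + (r - s) • v := by
        rw [eq_sub_of_add_eq h]
        simp only [smul_zero, zero_add]
        module
      rw [hI, Set.mem_ofPred_eq, ← this]
      exact hp
    · rintro ⟨s, h0, h1, h⟩
      refine ⟨_, h, _, ⟨s, ⟨h0, h1⟩, rfl⟩, ?_⟩
      simp only [smul_zero, zero_add]
      module
  -- The endpoint `b` is the last parameter at which the line is still in `P`; it is attained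
  -- because `I` is closed.
  refine ⟨sSup I, fun r => ?_⟩
  rw [hseg]
  constructor
  · rintro ⟨⟨s, h0, h1, h⟩, hr⟩
    have hle := le_csSup hbdd h
    refine ⟨?_, by linarith⟩
    by_contra hlt
    exact hr (hord.out h hmem ⟨by linarith, not_lt.mp hlt⟩)
  · rintro ⟨h1, h2⟩
    refine ⟨⟨r - sSup I, by linarith, by linarith, ?_⟩, fun h => ?_⟩
    · rw [sub_sub_cancel]
      exact hmem
    · exact absurd (le_csSup hbdd h) (not_le.mpr h1)

variable {c : Λ →+ V} {L : AddSubgroup Λ}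

/-- The points gained on each line parallel to `c u` form a half-open interval of length one, so
each class modulo `L ⊔ ℤu` that meets `P + ℝ (c u)` has exactly one gained representative modulo
`L`. Invariance of `P` under `L` makes membership independent of the representative. -/
theorem encard_hits_add_segment {P : Set V} {u : Λ} (hconv : Convex ℝ P)
    (hclosed : ∀ a, IsClosed {r : ℝ | a + r • c u ∈ P})
    (hbdd : ∀ a, BddAbove {r : ℝ | a + r • c u ∈ P})
    (hP : ∀ l ∈ L, ∀ p ∈ P, p + c l ∈ P) :
    (hits c L (P + segment ℝ 0 (c u))).encard = (hits c L P).encard +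
      (hits c (L ⊔ AddSubgroup.zmultiples u) (P + (Submodule.span ℝ {c u} : Set V))).encard := by
  have hP' : ∀ l ∈ L, ∀ p ∈ P + segment ℝ 0 (c u), p + c l ∈ P + segment ℝ 0 (c u) := by
    rintro l hl _ ⟨p, hp, q, hq, rfl⟩
    exact ⟨p + c l, hP l hl p hp, q, hq, by simp only; abel⟩
  have hsub : P ⊆ P + segment ℝ 0 (c u) := fun p hp =>
    ⟨p, hp, 0, left_mem_segment ℝ _ _, add_zero p⟩
  have hsplit : hits c L (P + segment ℝ 0 (c u)) =
      hits c L P ∪ hits c L ((P + segment ℝ 0 (c u)) \ P) := by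
    rw [hits, hits, hits, ← Set.image_union, ← Set.preimage_union, Set.union_sdiff_cancel hsub]
  have hPd : ∀ l ∈ L, ∀ p ∈ (P + segment ℝ 0 (c u)) \ P,
      p + c l ∈ (P + segment ℝ 0 (c u)) \ P := by
    rintro l hl p ⟨hp, hp'⟩
    refine ⟨hP' l hl p hp, fun h => hp' ?_⟩
    have := hP (-l) (L.neg_mem hl) _ h
    simpa using this
  have hdisj : Disjoint (hits c L P) (hits c L ((P + segment ℝ 0 (c u)) \ P)) := by
    rw [Set.disjoint_left]
    intro q
    induction q using QuotientAddGroup.induction_on with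
    | H x =>
      rw [mem_hits hP, mem_hits hPd]
      exact fun h h' => h'.2 h
  rw [hsplit, Set.encard_union_eq hdisj]
  congr 1
  -- This projection restricts to a bijection from the gained classes onto the classes of the
  -- contraction.
  let f : Λ ⧸ L →+ Λ ⧸ (L ⊔ AddSubgroup.zmultiples u) :=
    QuotientAddGroup.map _ _ (AddMonoidHom.id Λ) (by
      rw [AddSubgroup.comap_id]; exact le_sup_left)
  have hline : ∀ x : Λ, c x ∈ P + (Submodule.span ℝ {c u} : Set V) →
      ∃ b : ℝ, ∀ r : ℝ, (c x + r • c u ∈ P + segment ℝ 0 (c u) ∧ c x + r • c u ∉ P) ↔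
        b < r ∧ r ≤ b + 1 := by
    rintro x ⟨p, hp, q, hq, hpq⟩
    obtain ⟨r, rfl⟩ := Submodule.mem_span_singleton.mp hq
    refine exists_halfOpen_of_line hconv (hclosed _) (hbdd _) ⟨-r, ?_⟩
    rw [Set.mem_ofPred_eq, ← hpq]
    simpa using hp
  have hd_line : ∀ p ∈ P + segment ℝ 0 (c u), p ∈ P + (Submodule.span ℝ {c u} : Set V) := by
    rintro _ ⟨p, hp, q, hq, rfl⟩
    refine ⟨p, hp, q, ?_, rfl⟩
    rw [segment_eq_image] at hq
    obtain ⟨s, -, rfl⟩ := hq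
    simpa using Submodule.smul_mem _ s (Submodule.mem_span_singleton_self (c u))
  have himage : f '' hits c L ((P + segment ℝ 0 (c u)) \ P) =
      hits c (L ⊔ AddSubgroup.zmultiples u) (P + (Submodule.span ℝ {c u} : Set V)) := by
    ext q
    constructor
    · rintro ⟨_, ⟨x, hx, rfl⟩, rfl⟩
      exact ⟨x, hd_line _ hx.1, rfl⟩
    · rintro ⟨x, hx, rfl⟩
      obtain ⟨b, hb⟩ := hline x hx
      -- The only integer in `(b, b + 1]` is `⌊b⌋ + 1`.
      have hk := (hb (⌊b⌋ + 1 : ℤ)).mpr ⟨by push_cast; exact Int.lt_floor_add_one b, by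
        push_cast; linarith [Int.floor_le b]⟩
      refine ⟨_, ⟨x + (⌊b⌋ + 1) • u, ?_, rfl⟩, ?_⟩
      · rw [Set.mem_preimage, map_add, map_zsmul, ← Int.cast_smul_eq_zsmul ℝ]
        exact hk
      · change ((x + (⌊b⌋ + 1) • u : Λ) : Λ ⧸ (L ⊔ AddSubgroup.zmultiples u)) = _
        refine (QuotientAddGroup.eq.mpr ?_).symm
        rw [neg_add_cancel_left]
        exact (le_sup_right : _ ≤ L ⊔ AddSubgroup.zmultiples u)
          (AddSubgroup.zsmul_mem_zmultiples u _)
  rw [← himage, Set.InjOn.encard_image]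
  rintro _ ⟨x, hx, rfl⟩ _ ⟨y, hy, rfl⟩ hxy
  have hxy' := QuotientAddGroup.eq.mp (hxy :
    ((x : Λ) : Λ ⧸ (L ⊔ AddSubgroup.zmultiples u)) = (y : Λ ⧸ (L ⊔ AddSubgroup.zmultiples u)))
  obtain ⟨l, hl, m, hm, hlm⟩ := AddSubgroup.mem_sup.mp hxy'
  obtain ⟨k, rfl⟩ := AddSubgroup.mem_zmultiples_iff.mp hm
  have hlm' : l + k • u = -x + y := hlm
  have hy_eq : y = x + l + k • u := by rw [add_assoc, hlm', add_neg_cancel_left]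
  obtain ⟨b, hb⟩ := hline x (hd_line _ hx.1)
  -- Both `0` and `k` lie in the same half-open interval of length one, hence coincide.
  have h0 := (hb 0).mp (by simpa using hx)
  have hk := (hb k).mp (by
    have := hPd (-l) (L.neg_mem hl) _ hy
    rw [hy_eq] at this
    have e : c (x + l + k • u) + c (-l) = c x + (k : ℝ) • c u := by
      rw [map_add, map_add, map_neg, map_zsmul, Int.cast_smul_eq_zsmul]
      abel
    rwa [e] at this)
  have hk0 : k = 0 := by
    have h1 : (k : ℝ) < 1 := by linarith
    have h2 : (-1 : ℝ) < k := by linarith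
    have h3 : k < 1 := by exact_mod_cast h1
    have h4 : -1 < k := by exact_mod_cast h2
    omega
  refine QuotientAddGroup.eq.mpr ?_
  rw [hy_eq, hk0]
  simpa [add_assoc] using hl

theorem map_mem_span_of_mem_closure {ι : Type*} {c : Λ →+ V} {u : ι → Λ} {T : Set ι} {l : Λ}
    (hl : l ∈ AddSubgroup.closure (u '' T)) :
    c l ∈ Submodule.span ℝ ((fun i => c (u i)) '' T) := by
  induction hl using AddSubgroup.closure_induction with
  | mem x hx =>
    obtain ⟨i, hi, rfl⟩ := hx
    exact Submodule.subset_span ⟨i, hi, rfl⟩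
  | zero => simp
  | add x y _ _ hx hy => rw [map_add]; exact Submodule.add_mem _ hx hy
  | neg x _ hx => rw [map_neg]; exact Submodule.neg_mem _ hx

end Hits

section Zonotope

/-- The number of classes modulo `L` of elements of `Λ` that `c` maps into `P`. -/
noncomputable def hitCount {Λ V : Type*} [AddCommGroup Λ] [AddCommGroup V] (c : Λ →+ V) (L : AddSubgroup Λ)
    (P : Set V) : ℕ∞ :=
  (hits c L P).encard

theorem hitCount_eq_zero {Λ V : Type*} [AddCommGroup Λ] [AddCommGroup V] (c : Λ →+ V) {L : AddSubgroup Λ} {P : Set V} (h : ∀ x, c x ∉ P) :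
    hitCount c L P = 0 := by
  rw [hitCount, Set.encard_eq_zero, hits, Set.image_eq_empty]
  exact Set.eq_empty_of_forall_notMem h

variable {Λ V ι : Type*} [AddCommGroup Λ] [NormedAddCommGroup V] [NormedSpace ℝ V]


theorem convex_sum_segment (v : ι → V) (R : Finset ι) :
    Convex ℝ (∑ i ∈ R, segment ℝ 0 (v i)) := by
  classical
  induction R using Finset.induction_on with
  | empty =>
    rw [Finset.sum_empty, ← Set.singleton_zero]
    exact convex_singleton 0
  | insert a R ha ih =>
    rw [Finset.sum_insert ha]
    exact (convex_segment _ _).add ih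

theorem isCompact_sum_segment (v : ι → V) (R : Finset ι) :
    IsCompact (∑ i ∈ R, segment ℝ 0 (v i)) := by
  classical
  induction R using Finset.induction_on with
  | empty => simp
  | insert a R ha ih =>
    rw [Finset.sum_insert ha]
    refine IsCompact.add ?_ ih
    rw [segment_eq_image]
    exact isCompact_Icc.image (by fun_prop)

theorem Submodule.segment_add_coe {W : Submodule ℝ V} {v : V} (hv : v ∈ W) :
    segment ℝ 0 v + (W : Set V) = W := by
  ext x
  constructor
  · rintro ⟨p, hp, q, hq, rfl⟩
    exact W.add_mem (W.convex.segment_subset W.zero_mem hv hp) hq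
  · intro hx
    exact ⟨0, left_mem_segment ℝ _ _, x, hx, zero_add x⟩

variable [FiniteDimensional ℝ V]

/-- The deletion-contraction recursion for the lattice points of a compact convex set, taken
modulo a subspace. -/
theorem encard_hits_add_segment_of_isCompact {c : Λ →+ V} {L : AddSubgroup Λ} {K : Set V}
    (hK : IsCompact K) (hconv : Convex ℝ K) {W : Submodule ℝ V} (hL : ∀ l ∈ L, c l ∈ W) {u : Λ}
    (hu : c u ∉ W) :
    hitCount c L (K + segment ℝ 0 (c u) + (W : Set V)) =
      hitCount c L (K + (W : Set V)) +
      hitCount c (L ⊔ AddSubgroup.zmultiples u)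
        (K + ((W ⊔ Submodule.span ℝ {c u} : Submodule ℝ V) : Set V)) := by
  rw [add_right_comm, Submodule.coe_sup, ← add_assoc]
  have hclosed : IsClosed (K + (W : Set V)) :=
    (Submodule.closed_of_finiteDimensional W).add_left_of_isCompact hK
  refine encard_hits_add_segment (hconv.add W.convex) (fun a => ?_) (fun a => ?_) ?_
  · exact hclosed.preimage (f := fun r : ℝ => a + r • c u) (by fun_prop)
  -- A functional that vanishes on `W` but not at `c u` is bounded on `K`, hence on `K + W`, and so
  -- bounds the parameter along the line.
  · obtain ⟨f, hf, hfW⟩ := Submodule.exists_le_ker_of_notMem hu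
    have hfc : Continuous f := LinearMap.continuous_of_finiteDimensional f
    obtain ⟨C, hC⟩ := (hK.image hfc).isBounded.exists_norm_le
    refine ⟨(C + ‖f a‖) / ‖f (c u)‖, ?_⟩
    rintro r ⟨k, hk, w, hw, hkw⟩
    have hfw : f w = 0 := hfW hw
    have h1 : r * f (c u) = f k - f a := by
      have := congrArg f hkw
      simp only [map_add, map_smul, hfw, smul_eq_mul] at this
      linarith
    have h2 : |r| * ‖f (c u)‖ ≤ C + ‖f a‖ := by
      rw [Real.norm_eq_abs, ← abs_mul, h1]
      have := hC _ ⟨k, hk, rfl⟩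
      exact (norm_sub_le (f k) (f a)).trans (by linarith)
    rw [le_div_iff₀ (norm_pos_iff.mpr hf)]
    exact (mul_le_mul_of_nonneg_right (le_abs_self r) (norm_nonneg _)).trans h2
  · rintro l hl _ ⟨k, hk, w, hw, rfl⟩
    exact ⟨k, hk, w + c l, W.add_mem hw (hL l hl), by simp only; abel⟩

-- Here `T` is the set of generators contracted so far and `R` the set still to be treated. The
-- induction splits the subsets of `insert a R` by whether they contain `a`: those without it come
-- from deleting `a`, those with it from contracting `a`.
open Classical in
theorem encard_hits_zonotope (c : Λ →+ V) (u : ι → Λ) (w : V) (R T : Finset ι)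
    (hdisj : Disjoint T R) (hT : LinearIndepOn ℝ (fun i => c (u i)) (T : Set ι)) :
    hitCount c (AddSubgroup.closure (u '' T)) ({w} + ∑ i ∈ R, segment ℝ 0 (c (u i)) +
      (Submodule.span ℝ ((fun i => c (u i)) '' T) : Set V)) =
    ∑ S ∈ R.powerset, if LinearIndepOn ℝ (fun i => c (u i)) ((T ∪ S : Finset ι) : Set ι) then
      hitCount c (AddSubgroup.closure (u '' ((T ∪ S : Finset ι) : Set ι))) ({w} +
        (Submodule.span ℝ ((fun i => c (u i)) '' ((T ∪ S : Finset ι) : Set ι)) : Set V))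
      else 0 := by
  induction R using Finset.induction_on generalizing T with
  | empty => simp [hT]
  | insert a R ha ih =>
    have haT : a ∉ T := fun h => Finset.disjoint_left.mp hdisj h (Finset.mem_insert_self a R)
    have hTR : Disjoint T R := hdisj.mono_right (Finset.subset_insert a R)
    rw [Finset.sum_powerset_insert ha, ← ih T hTR hT, Finset.sum_insert ha,
      add_comm (segment ℝ 0 (c (u a))), ← add_assoc]
    by_cases hmem : c (u a) ∈ Submodule.span ℝ ((fun i => c (u i)) '' (T : Set ι))
    -- A generator in the span of `T` is absorbed by that span, and every subset containing it is
    -- dependent together with `T`, so the contracted half of the sum vanishes.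
    · rw [add_assoc _ (segment ℝ 0 (c (u a))), Submodule.segment_add_coe hmem]
      refine (add_zero _).symm.trans
        (congrArg (HAdd.hAdd _) (Finset.sum_eq_zero fun S _ => ?_).symm)
      refine if_neg fun h => ?_
      have h' : LinearIndepOn ℝ (fun i => c (u i)) (insert a (T : Set ι)) :=
        h.mono (by intro x hx; simp only [Finset.coe_union, Finset.coe_insert]; aesop)
      exact ((linearIndepOn_insert (by simpa using haT)).mp h').2 hmem
    · have hT' : LinearIndepOn ℝ (fun i => c (u i)) ((insert a T : Finset ι) : Set ι) := by
        rw [Finset.coe_insert]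
        exact hT.insert hmem
      have hdisj' : Disjoint (insert a T) R := by
        rw [Finset.disjoint_insert_left]
        exact ⟨ha, hTR⟩
      rw [encard_hits_add_segment_of_isCompact
        (isCompact_singleton.add (isCompact_sum_segment (fun i => c (u i)) R))
        ((convex_singleton w).add (convex_sum_segment (fun i => c (u i)) R))
        (fun l hl => map_mem_span_of_mem_closure hl) hmem]
      congr 1
      have h1 : AddSubgroup.closure (u '' (T : Set ι)) ⊔ AddSubgroup.zmultiples (u a) =
          AddSubgroup.closure (u '' ((insert a T : Finset ι) : Set ι)) := by
        rw [Finset.coe_insert, Set.image_insert_eq, Set.insert_eq, AddSubgroup.closure_union,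
          ← AddSubgroup.zmultiples_eq_closure, sup_comm]
      have h2 : Submodule.span ℝ ((fun i => c (u i)) '' (T : Set ι)) ⊔
          Submodule.span ℝ {c (u a)} =
          Submodule.span ℝ ((fun i => c (u i)) '' ((insert a T : Finset ι) : Set ι)) := by
        rw [Finset.coe_insert, Set.image_insert_eq, Submodule.span_insert, sup_comm]
      rw [h1, h2, ih (insert a T) hdisj' hT']
      refine Finset.sum_congr rfl fun S _ => ?_
      rw [Finset.insert_union, Finset.union_insert]

open Classical in
/-- The number of lattice points of a translated lattice zonotope, as a sum over the linearly
independent subsets of its generators. -/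
theorem encard_preimage_zonotope (c : Λ →+ V) (u : ι → Λ) (w : V) (R : Finset ι) :
    (c ⁻¹' ({w} + ∑ i ∈ R, segment ℝ 0 (c (u i)))).encard =
    ∑ S ∈ R.powerset, if LinearIndepOn ℝ (fun i => c (u i)) (S : Set ι) then
      hitCount c (AddSubgroup.closure (u '' (S : Set ι))) ({w} +
        (Submodule.span ℝ ((fun i => c (u i)) '' (S : Set ι)) : Set V)) else 0 := by
  have h := encard_hits_zonotope c u w R ∅ (Finset.disjoint_empty_left R) (by simp)
  simp only [Finset.empty_union] at h
  rw [← h, hitCount, hits, Set.InjOn.encard_image]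
  · simp
  · intro x _ y _ hxy
    have := QuotientAddGroup.eq.mp hxy
    simp only [Finset.coe_empty, Set.image_empty, AddSubgroup.closure_empty,
      AddSubgroup.mem_bot] at this
    rw [neg_add_eq_zero] at this
    exact this

-- The elements of `Λ` over the flat form a coset of the preimage of `W`, so their classes are a
-- translate of the image of that preimage in `Λ ⧸ L`. The hypothesis `hL` excludes infinite index,
-- for which `relIndex` takes the value `0`.
omit [FiniteDimensional ℝ V] in
theorem hitCount_add_submodule (c : Λ →+ V) {L : AddSubgroup Λ} {W : Submodule ℝ V} {w : V} {x : Λ}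
    (hx : c x ∈ ({w} + (W : Set V))) (hL : L.relIndex (W.toAddSubgroup.comap c) ≠ 0) :
    hitCount c L ({w} + (W : Set V)) = (L.relIndex (W.toAddSubgroup.comap c) : ℕ∞) := by
  have hmem : ∀ y, c y ∈ ({w} + (W : Set V)) ↔ c y - w ∈ W := by
    intro y
    rw [Set.singleton_add, Set.mem_image]
    constructor
    · rintro ⟨z, hz, hzy⟩
      rw [← hzy, add_sub_cancel_left]
      exact hz
    · exact fun h => ⟨_, h, add_sub_cancel _ _⟩
  rw [hmem] at hx
  have himage : hits c L ({w} + (W : Set V)) = (fun q => (x : Λ ⧸ L) + q) ''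
      ((W.toAddSubgroup.comap c).map (QuotientAddGroup.mk' L) : Set (Λ ⧸ L)) := by
    ext q
    constructor
    · rintro ⟨y, hy, rfl⟩
      rw [Set.mem_preimage, hmem] at hy
      refine ⟨_, ⟨y - x, ?_, rfl⟩, ?_⟩
      · change c (y - x) ∈ W
        rw [map_sub]
        have := W.sub_mem hy hx
        rwa [sub_sub_sub_cancel_right] at this
      · change ((x + (y - x) : Λ) : Λ ⧸ L) = _
        rw [add_sub_cancel]
    · rintro ⟨_, ⟨y, hy, rfl⟩, rfl⟩
      refine ⟨x + y, ?_, rfl⟩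
      rw [Set.mem_preimage, hmem, map_add, add_sub_right_comm]
      exact W.add_mem hx hy
  have hcard : L.relIndex (W.toAddSubgroup.comap c) =
      Nat.card ((W.toAddSubgroup.comap c).map (QuotientAddGroup.mk' L)) := by
    rw [← AddSubgroup.relIndex_ker, QuotientAddGroup.ker_mk']
  rw [hitCount, himage, (add_right_injective _).encard_image]
  rw [hcard] at hL ⊢
  have : Finite ((W.toAddSubgroup.comap c).map (QuotientAddGroup.mk' L)) :=
    Nat.finite_of_card_ne_zero hL
  exact (Set.Finite.cast_ncard_eq (s := ((W.toAddSubgroup.comap c).map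
    (QuotientAddGroup.mk' L) : Set (Λ ⧸ L))) (Set.toFinite _)).symm

end Zonotope

/-! ### Index of a dilated lattice -/

section Dilation

variable {Λ ι : Type*} [AddCommGroup Λ]

/-- Multiplying `k` independent generators by `t` multiplies the index by `t ^ k`. -/
theorem relIndex_closure_nsmul (u : ι → Λ) (S : Finset ι) (hS : LinearIndepOn ℤ u (S : Set ι))
    (t : ℕ) :
    (AddSubgroup.closure ((fun i => t • u i) '' (S : Set ι))).relIndex
      (AddSubgroup.closure (u '' (S : Set ι))) = t ^ S.card := by
  classical
  -- In coordinates with respect to the independent generators, the two subgroups are `ℤ^S` and the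
  -- kernel of reduction modulo `t`.
  let φ : (S → ℤ) →+ Λ := (Fintype.linearCombination ℤ (fun i : S => u i)).toAddMonoidHom
  have hφ : Function.Injective φ :=
    linearIndependent_iff_injective_fintypeLinearCombination.mp hS
  let red : (S → ℤ) →+ (S → ZMod t) := (Int.castAddHom (ZMod t)).compLeft S
  have hsingle : ∀ i : S, φ (Pi.single i 1) = u i := fun i => by
    simp [φ, Fintype.linearCombination_apply_single]
  have h1 : (⊤ : AddSubgroup (S → ℤ)).map φ = AddSubgroup.closure (u '' (S : Set ι)) := by
    apply le_antisymm
    · rintro _ ⟨x, -, rfl⟩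
      change Fintype.linearCombination ℤ (fun i : S => u i) x ∈ _
      rw [Fintype.linearCombination_apply]
      exact sum_mem fun i _ => AddSubgroup.zsmul_mem _
        (AddSubgroup.subset_closure (Set.mem_image_of_mem _ i.2)) _
    · rw [AddSubgroup.closure_le]
      rintro _ ⟨i, hi, rfl⟩
      exact ⟨Pi.single ⟨i, hi⟩ 1, trivial, hsingle ⟨i, hi⟩⟩
  have h2 : red.ker.map φ = AddSubgroup.closure ((fun i => t • u i) '' (S : Set ι)) := by
    apply le_antisymm
    · rintro _ ⟨x, hx, rfl⟩
      change Fintype.linearCombination ℤ (fun i : S => u i) x ∈ _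
      rw [Fintype.linearCombination_apply]
      refine sum_mem fun i _ => ?_
      have hx' : ((x i : ℤ) : ZMod t) = 0 := congrFun (AddMonoidHom.mem_ker.mp hx) i
      obtain ⟨k, hk⟩ := (ZMod.intCast_zmod_eq_zero_iff_dvd _ _).mp hx'
      rw [hk, mul_comm, mul_smul, natCast_zsmul]
      exact AddSubgroup.zsmul_mem _ (AddSubgroup.subset_closure (Set.mem_image_of_mem _ i.2)) _
    · rw [AddSubgroup.closure_le]
      rintro _ ⟨i, hi, rfl⟩
      refine ⟨t • (Pi.single ⟨i, hi⟩ 1 : S → ℤ), ?_, ?_⟩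
      · change red (t • (Pi.single ⟨i, hi⟩ 1 : S → ℤ)) = 0
        rw [map_nsmul]
        ext j
        simp
      · rw [map_nsmul, hsingle]
  rw [← h1, ← h2, AddSubgroup.relIndex_map_map_of_injective _ _ hφ, AddSubgroup.relIndex_top_right,
    AddSubgroup.index_ker, AddMonoidHom.range_eq_top.mpr]
  · rw [Nat.card_congr AddSubgroup.topEquiv.toEquiv]
    simp [Nat.card_fun]
  · intro y
    exact ⟨fun i => (y i).cast, by ext i; simp [red]⟩

end Dilation

/-! ### Cycles of signed graphs -/

namespace SignedGraph

variable {V : Type*} {G : SignedGraph V}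

theorem mem_edges_iff {i j : V} {σ : ℤˣ} :
    (s(i, j), σ) ∈ G.edges ↔ (G.pos.Adj i j ∧ σ = 1) ∨ (G.neg.Adj i j ∧ σ = -1) := by
  simp [edges]

theorem ne_of_mem_edges {i j : V} {σ : ℤˣ} (h : (s(i, j), σ) ∈ G.edges) : i ≠ j := by
  rw [mem_edges_iff] at h
  rcases h with h | h
  · exact h.1.ne
  · exact h.1.ne

theorem underlying_adj_iff {i j : V} :
    G.underlying.Adj i j ↔ ∃ σ, (s(i, j), σ) ∈ G.edges := by
  simp only [mem_edges_iff, underlying, SimpleGraph.sup_adj]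
  constructor
  · rintro (h | h)
    · exact ⟨1, Or.inl ⟨h, rfl⟩⟩
    · exact ⟨-1, Or.inr ⟨h, rfl⟩⟩
  · rintro ⟨σ, h | h⟩
    · exact Or.inl h.1
    · exact Or.inr h.1

theorem image_fst_edges : Prod.fst '' G.edges = G.underlying.edgeSet := by
  ext p
  induction p using Sym2.ind with
  | _ i j =>
    rw [SimpleGraph.mem_edgeSet, underlying_adj_iff]
    constructor
    · rintro ⟨⟨_, σ⟩, h, rfl⟩
      exact ⟨σ, h⟩
    · rintro ⟨σ, h⟩
      exact ⟨_, h, rfl⟩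

theorem Connected.card_le_ncard_edges_add_one [Finite V] (hG : G.Connected) :
    Nat.card V ≤ G.edges.ncard + 1 := by
  have h := SimpleGraph.Connected.card_vert_le_card_edgeSet_add_one hG
  rw [← image_fst_edges, Nat.card_coe_set_eq] at h
  exact h.trans (Nat.add_le_add_right (Set.ncard_image_le (Set.toFinite _)) 1)

theorem exists_isCycle_of_parallel {i j : V} (h1 : (s(i, j), 1) ∈ G.edges)
    (h2 : (s(i, j), -1) ∈ G.edges) : ∃ C, G.IsCycle C := by
  have hne := ne_of_mem_edges h1
  have hsign : (1 : ℤˣ) ≠ -1 := by decide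
  -- `ZMod 2` unfolds to `Fin 2`, so the cyclic sequences can be written as vectors.
  refine ⟨_, 2, (![i, j] : Fin 2 → V), (![1, -1] : Fin 2 → ℤˣ), le_rfl, ?_, ?_, ?_, rfl⟩
  · intro a b hab
    fin_cases a <;> fin_cases b <;> first | rfl | simp_all
  · intro a b hab
    have h' := congrArg Prod.snd hab
    fin_cases a <;> fin_cases b <;> first | rfl | simp_all
  · intro a
    fin_cases a
    · exact h1
    · exact Sym2.eq_swap ▸ h2

/-- The vertices of the closed walk are indexed by residues modulo its length, and any available
sign is chosen for each step. Since the length is at least three, no edge is traversed twice. -/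
theorem exists_isCycle_of_walk {a : V} {w : G.underlying.Walk a a} (hw : w.IsCycle) :
    ∃ C, G.IsCycle C := by
  have h3 : 3 ≤ w.length := hw.three_le_length
  have : NeZero w.length := ⟨by omega⟩
  have hval : ∀ k : ZMod w.length, w.getVert (k + 1).val = w.getVert (k.val + 1) := by
    intro k
    have hk := ZMod.val_lt k
    rcases eq_or_lt_of_le (Nat.succ_le_of_lt hk) with h | h
    · have h0 : k + 1 = 0 := by
        rw [← ZMod.natCast_zmod_val k, ← Nat.cast_one (R := ZMod w.length), ← Nat.cast_add]
        rw [show k.val + 1 = w.length from h, ZMod.natCast_self]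
      rw [h0, ZMod.val_zero, show k.val + 1 = w.length from h]
      simp
    · have h1 : (1 : ZMod w.length).val = 1 := by
        rw [← Nat.cast_one, ZMod.val_natCast_of_lt (by omega)]
      rw [ZMod.val_add_of_lt (by rw [h1]; exact h), h1]
  have hadj : ∀ k : ZMod w.length,
      G.underlying.Adj (w.getVert k.val) (w.getVert (k + 1).val) := by
    intro k
    rw [hval]
    exact w.adj_getVert_succ (ZMod.val_lt k)
  have hex := fun k => underlying_adj_iff.mp (hadj k)
  choose sg hsg using hex
  have hinj : Function.Injective fun k : ZMod w.length => w.getVert k.val := by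
    intro k l hkl
    have := ZMod.val_lt k
    have := ZMod.val_lt l
    exact ZMod.val_injective _ (hw.getVert_injOn' (by simp; omega) (by simp; omega) hkl)
  refine ⟨_, w.length, fun k => w.getVert k.val, sg, by omega, hinj, ?_, hsg, rfl⟩
  intro k l hkl
  have hkl' := congrArg Prod.fst hkl
  simp only [Sym2.eq_iff] at hkl'
  rcases hkl' with ⟨h, -⟩ | ⟨h1, h2⟩
  · exact hinj h
  · have e1 : k = l + 1 := hinj h1
    have e2 : k + 1 = l := hinj h2
    -- An edge traversed in both directions would force the length to divide two.
    have e3 : ((2 : ℕ) : ZMod w.length) = 0 := by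
      rw [e1, add_assoc, add_eq_left] at e2
      rw [← e2]
      norm_num
    rw [ZMod.natCast_eq_zero_iff] at e3
    have := Nat.le_of_dvd (by norm_num) e3
    omega

/-- Without cycles the underlying graph is a tree, and there are no parallel edges, so forgetting
signs is injective on edges. -/
theorem Connected.ncard_edges_of_forall_not_isCycle [Finite V] (hG : G.Connected)
    (h : ∀ C, ¬ G.IsCycle C) : G.edges.ncard + 1 = Nat.card V := by
  have hacyc : G.underlying.IsAcyclic := fun a w hw =>
    (exists_isCycle_of_walk hw).elim fun C hC => h C hC
  have hcard := (SimpleGraph.isTree_iff_connected_and_card.mp ⟨hG, hacyc⟩).2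
  rw [← hcard, ← image_fst_edges, Nat.card_coe_set_eq, Set.InjOn.ncard_image]
  rintro ⟨p, σ⟩ hp ⟨q, τ⟩ hq hpq
  obtain rfl : p = q := hpq
  induction p using Sym2.ind with
  | _ i j =>
    by_contra hne
    have hστ : σ ≠ τ := fun h' => hne (by rw [h'])
    rcases Int.units_eq_one_or σ with rfl | rfl <;> rcases Int.units_eq_one_or τ with rfl | rfl
    · exact hστ rfl
    · exact (exists_isCycle_of_parallel hp hq).elim h
    · exact (exists_isCycle_of_parallel hq hp).elim h
    · exact hστ rfl

/-- The signed graph with the edge `e` removed. -/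
def deleteEdge (G : SignedGraph V) (e : Sym2 V × ℤˣ) : SignedGraph V where
  pos := G.pos.deleteEdges {p | (p, 1) = e}
  neg := G.neg.deleteEdges {p | (p, -1) = e}
  half := G.half
  loop := G.loop

theorem edges_deleteEdge (e : Sym2 V × ℤˣ) : (G.deleteEdge e).edges = G.edges \ {e} := by
  ext ⟨p, σ⟩
  simp only [edges, deleteEdge, SimpleGraph.edgeSet_deleteEdges, Set.mem_sdiff,
    Set.mem_ofPred_eq, Set.mem_singleton_iff]
  constructor
  · rintro (⟨⟨h, h'⟩, rfl⟩ | ⟨⟨h, h'⟩, rfl⟩)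
    · exact ⟨Or.inl ⟨h, rfl⟩, h'⟩
    · exact ⟨Or.inr ⟨h, rfl⟩, h'⟩
  · rintro ⟨⟨h, rfl⟩ | ⟨h, rfl⟩, h'⟩
    · exact Or.inl ⟨⟨h, h'⟩, rfl⟩
    · exact Or.inr ⟨⟨h, h'⟩, rfl⟩

theorem ncard_edges_deleteEdge [Finite V] {e : Sym2 V × ℤˣ} (he : e ∈ G.edges) :
    (G.deleteEdge e).edges.ncard + 1 = G.edges.ncard := by
  rw [edges_deleteEdge, Set.ncard_sdiff_singleton_add_one he (Set.toFinite _)]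

theorem IsCycle.subset_edges {C : Set (Sym2 V × ℤˣ)} (hC : G.IsCycle C) : C ⊆ G.edges := by
  obtain ⟨m, v, s, -, -, -, hs, rfl⟩ := hC
  rintro _ ⟨i, rfl⟩
  exact hs i

theorem IsCycle.nonempty {C : Set (Sym2 V × ℤˣ)} (hC : G.IsCycle C) : C.Nonempty := by
  obtain ⟨m, v, s, -, -, -, hs, rfl⟩ := hC
  exact ⟨_, 0, rfl⟩

theorem isCycle_deleteEdge_iff {e : Sym2 V × ℤˣ} {C : Set (Sym2 V × ℤˣ)} :
    (G.deleteEdge e).IsCycle C ↔ G.IsCycle C ∧ e ∉ C := by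
  constructor
  · intro h
    refine ⟨?_, fun he => ?_⟩
    · obtain ⟨m, v, s, hm, hv, hinj, hs, hC⟩ := h
      refine ⟨m, v, s, hm, hv, hinj, fun i => ?_, hC⟩
      have := hs i
      rw [edges_deleteEdge] at this
      exact this.1
    · have := h.subset_edges he
      rw [edges_deleteEdge] at this
      exact this.2 rfl
  · rintro ⟨⟨m, v, s, hm, hv, hinj, hs, rfl⟩, he⟩
    refine ⟨m, v, s, hm, hv, hinj, fun i => ?_, rfl⟩
    rw [edges_deleteEdge]
    exact ⟨hs i, fun h => he ⟨i, h⟩⟩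

/-- The rest of the cycle is a detour between the ends of the deleted edge. -/
theorem Connected.deleteEdge {C : Set (Sym2 V × ℤˣ)} (hG : G.Connected) (hC : G.IsCycle C)
    {e : Sym2 V × ℤˣ} (he : e ∈ C) : (G.deleteEdge e).Connected := by
  obtain ⟨m, v, s, hm, hv, hinj, hs, rfl⟩ := hC
  obtain ⟨i₀, rfl⟩ := he
  have : NeZero m := ⟨by omega⟩
  simp only
  set H := G.deleteEdge (s(v i₀, v (i₀ + 1)), s i₀) with hH
  -- Fewer than `m` steps starting at `i₀ + 1` never use the edge with index `i₀`.
  have hround : ∀ k : ℕ, k < m → H.underlying.Reachable (v (i₀ + 1)) (v (i₀ + 1 + k)) := by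
    intro k
    induction k with
    | zero => intro _; simp
    | succ k ih =>
      intro hk
      refine (ih (by omega)).trans (SimpleGraph.Adj.reachable ?_)
      rw [underlying_adj_iff]
      refine ⟨s (i₀ + 1 + k), ?_⟩
      rw [Nat.cast_add, Nat.cast_one, ← add_assoc, hH, edges_deleteEdge]
      refine ⟨hs _, fun h => ?_⟩
      have h' := hinj h
      rw [add_assoc, add_eq_left, add_comm, ← Nat.cast_one (R := ZMod m), ← Nat.cast_add,
        ZMod.natCast_eq_zero_iff] at h'
      have := Nat.le_of_dvd (by omega) h'
      omega
  have hreach : H.underlying.Reachable (v (i₀ + 1)) (v i₀) := by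
    have h := hround (m - 1) (by omega)
    have e : i₀ + 1 + ((m - 1 : ℕ) : ZMod m) = i₀ := by
      rw [Nat.cast_sub (by omega), ZMod.natCast_self]
      ring
    rwa [e] at h
  have hadj : ∀ i j, G.underlying.Adj i j → H.underlying.Reachable i j := by
    intro i j hij
    obtain ⟨σ, hσ⟩ := underlying_adj_iff.mp hij
    by_cases h : (s(i, j), σ) = (s(v i₀, v (i₀ + 1)), s i₀)
    · have h' := congrArg Prod.fst h
      simp only [Sym2.eq_iff] at h'
      rcases h' with ⟨rfl, rfl⟩ | ⟨rfl, rfl⟩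
      · exact hreach.symm
      · exact hreach
    · refine SimpleGraph.Adj.reachable (underlying_adj_iff.mpr ⟨σ, ?_⟩)
      rw [hH, edges_deleteEdge]
      exact ⟨hσ, h⟩
  have hGc : G.underlying.Connected := hG
  have := hGc.nonempty
  refine SimpleGraph.Connected.mk fun i j => ?_
  obtain ⟨w⟩ := hGc.preconnected i j
  induction w with
  | nil => rfl
  | cons h _ ih => exact (hadj _ _ h).trans ih

/-- Since the indexing of the edges is injective, counting negative edges is counting indices of
sign `-1`, and the parity of that number is the product of the signs. -/
theorem isBalancedCycle_iff_prod {m : ℕ} [NeZero m] {v : ZMod m → V} {s : ZMod m → ℤˣ}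
    (hinj : Function.Injective fun i => (s(v i, v (i + 1)), s i)) :
    IsBalancedCycle (Set.range fun i => (s(v i, v (i + 1)), s i)) ↔ ∏ i, s i = 1 := by
  classical
  have h1 : {e ∈ Set.range fun i => (s(v i, v (i + 1)), s i) | e.2 = -1} =
      (fun i => (s(v i, v (i + 1)), s i)) '' {i | s i = -1} := by
    ext e
    constructor
    · rintro ⟨⟨i, rfl⟩, h⟩
      exact ⟨i, h, rfl⟩
    · rintro ⟨i, h, rfl⟩
      exact ⟨⟨i, rfl⟩, h⟩
  have h2 : ∏ i, s i = (-1) ^ (Finset.univ.filter fun i => s i = -1).card := by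
    rw [← Finset.prod_const, Finset.prod_filter]
    refine Finset.prod_congr rfl fun i _ => ?_
    rcases Int.units_eq_one_or (s i) with h | h <;> simp [h]
  rw [IsBalancedCycle, h1, Set.ncard_image_of_injective _ hinj, Set.ncard_eq_toFinset_card', h2,
    Set.toFinset_ofPred]
  rcases Nat.even_or_odd (Finset.univ.filter fun i => s i = -1).card with h | h
  · simp [h, h.neg_one_pow]
  · simp [h.neg_one_pow, Nat.not_even_iff_odd.mpr h]

/-- `ε` switches all edges of `G` to positive ones. -/
def SwitchedBy (G : SignedGraph V) (ε : V → ℤˣ) : Prop :=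
  ∀ i j σ, (s(i, j), σ) ∈ G.edges → ε i = σ * ε j

/-- `G` has no halfedges and no loops, and some switching makes all its edges positive. -/
def Balanced (G : SignedGraph V) : Prop :=
  (∃ ε, G.SwitchedBy ε) ∧ G.half = ∅ ∧ G.loop = ∅

/-- Multiplying each `s i` by `ε (v i) * ε (v (i + 1))` leaves the cyclic product unchanged, because
every vertex sign occurs twice; afterwards only the factor at `i₀` can differ from `1`. -/
theorem prod_sign_eq {m : ℕ} [NeZero m] {v : ZMod m → V} {s : ZMod m → ℤˣ} {ε : V → ℤˣ}
    {i₀ : ZMod m} (h : ∀ i, i ≠ i₀ → ε (v i) = s i * ε (v (i + 1))) :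
    ∏ i, s i = s i₀ * (ε (v i₀) * ε (v (i₀ + 1))) := by
  have h1 : ∏ i, s i = ∏ i, s i * (ε (v i) * ε (v (i + 1))) := by
    have := Equiv.prod_comp (Equiv.addRight (1 : ZMod m)) fun i => ε (v i)
    simp only [Equiv.coe_addRight] at this
    rw [Finset.prod_mul_distrib, Finset.prod_mul_distrib, this, Int.units_mul_self, mul_one]
  rw [h1]
  refine Finset.prod_eq_single i₀ (fun i _ hi => ?_) (by simp)
  rw [h i hi, mul_assoc, Int.units_mul_self, mul_one, Int.units_mul_self]

theorem SwitchedBy.isBalancedCycle {ε : V → ℤˣ} (hε : G.SwitchedBy ε)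
    {C : Set (Sym2 V × ℤˣ)} (hC : G.IsCycle C) : IsBalancedCycle C := by
  obtain ⟨m, v, s, hm, hv, hinj, hs, rfl⟩ := hC
  have : NeZero m := ⟨by omega⟩
  rw [isBalancedCycle_iff_prod hinj, prod_sign_eq (i₀ := 0) fun i _ => hε _ _ _ (hs i),
    hε _ _ _ (hs 0), mul_assoc, Int.units_mul_self, mul_one, Int.units_mul_self]

/-- On a balanced cycle the switching relation on all edges but one forces it on the last, by
`prod_sign_eq`. -/
theorem SwitchedBy.of_deleteEdge {ε : V → ℤˣ} {C : Set (Sym2 V × ℤˣ)} (hC : G.IsCycle C)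
    (hbal : IsBalancedCycle C) {e : Sym2 V × ℤˣ} (he : e ∈ C)
    (hε : (G.deleteEdge e).SwitchedBy ε) : G.SwitchedBy ε := by
  obtain ⟨m, v, s, hm, hv, hinj, hs, rfl⟩ := hC
  have : NeZero m := ⟨by omega⟩
  obtain ⟨i₀, rfl⟩ := he
  simp only at hε
  have h1 : s i₀ * (ε (v i₀) * ε (v (i₀ + 1))) = 1 := by
    rw [← prod_sign_eq, (isBalancedCycle_iff_prod hinj).mp hbal]
    intro i hi
    refine hε _ _ _ ?_
    rw [edges_deleteEdge]
    exact ⟨hs i, fun h => hi (hinj h)⟩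
  have h2 : ε (v i₀) = s i₀ * ε (v (i₀ + 1)) := by
    rw [← mul_assoc, mul_eq_one_iff_eq_inv, Int.units_inv_eq_self] at h1
    rw [← h1, ← mul_assoc, Int.units_mul_self, one_mul]
  intro i j σ hσ
  by_cases h : (s(i, j), σ) = (s(v i₀, v (i₀ + 1)), s i₀)
  · have h' := congrArg Prod.fst h
    have hσ' : σ = s i₀ := congrArg Prod.snd h
    subst hσ'
    simp only [Sym2.eq_iff] at h'
    rcases h' with ⟨rfl, rfl⟩ | ⟨rfl, rfl⟩
    · exact h2
    · rw [h2, ← mul_assoc, Int.units_mul_self, one_mul]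
  · refine hε _ _ _ ?_
    rw [edges_deleteEdge]
    exact ⟨hσ, h⟩

end SignedGraph

/-! ### The lattice spanned by the edge vectors of a signed graph -/

/-- The inclusion `ℤⁿ → ℝⁿ`. -/
noncomputable def latticeCast (V : Type*) : (V → ℤ) →+ (V → ℝ) := (Int.castAddHom ℝ).compLeft V

@[simp]
theorem latticeCast_apply {V : Type*} (x : V → ℤ) (v : V) : latticeCast V x v = (x v : ℝ) := rfl

namespace SignedGraph

section ComponentBalance

variable {V : Type*} {G : SignedGraph V}

/-- The part of `G` incident with `S` is balanced. -/
def BalancedOn (G : SignedGraph V) (S : Set V) : Prop :=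
  (∃ ε : V → ℤˣ, ∀ i ∈ S, ∀ j σ, (s(i, j), σ) ∈ G.edges → ε i = σ * ε j) ∧
    ∀ v ∈ S, v ∉ G.half ∧ v ∉ G.loop

theorem balanced_iff_balancedOn_univ : G.Balanced ↔ G.BalancedOn Set.univ := by
  simp only [Balanced, BalancedOn, SwitchedBy, Set.mem_univ, true_imp_iff, forall_and,
    Set.eq_empty_iff_forall_notMem]

theorem mem_edges_component_iff {c : G.underlying.ConnectedComponent} {i j : c.supp} {σ : ℤˣ} :
    (s(i, j), σ) ∈ (G.component c).edges ↔ (s((i : V), (j : V)), σ) ∈ G.edges := by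
  rw [mem_edges_iff, mem_edges_iff]
  rfl

theorem connectedComponentMk_eq_of_mem_edges {i j : V} {σ : ℤˣ} (h : (s(i, j), σ) ∈ G.edges) :
    G.underlying.connectedComponentMk i = G.underlying.connectedComponentMk j :=
  SimpleGraph.ConnectedComponent.connectedComponentMk_eq_of_adj
    (underlying_adj_iff.mpr ⟨σ, h⟩)

/-- Edges do not leave a component, so signs on it may be extended arbitrarily. This replaces
functions on the subtype by functions on `V`. -/
theorem component_balanced_iff {c : G.underlying.ConnectedComponent} :
    (G.component c).Balanced ↔ G.BalancedOn c.supp := by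
  classical
  have hhalf : (G.component c).half = ∅ ↔ ∀ v ∈ c.supp, v ∉ G.half := by
    rw [Set.eq_empty_iff_forall_notMem]
    exact ⟨fun h v hv => h ⟨v, hv⟩, fun h v => h v v.2⟩
  have hloop : (G.component c).loop = ∅ ↔ ∀ v ∈ c.supp, v ∉ G.loop := by
    rw [Set.eq_empty_iff_forall_notMem]
    exact ⟨fun h v hv => h ⟨v, hv⟩, fun h v => h v v.2⟩
  have hε : (∃ ε, (G.component c).SwitchedBy ε) ↔
      ∃ ε : V → ℤˣ, ∀ i ∈ c.supp, ∀ j σ, (s(i, j), σ) ∈ G.edges → ε i = σ * ε j := by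
    constructor
    · rintro ⟨ε, h⟩
      refine ⟨fun v => if hv : v ∈ c.supp then ε ⟨v, hv⟩ else 1, fun i hi j σ hσ => ?_⟩
      have hj : j ∈ c.supp := by
        rw [SimpleGraph.ConnectedComponent.mem_supp_iff] at hi ⊢
        rw [← connectedComponentMk_eq_of_mem_edges hσ, hi]
      simp only [dif_pos hi, dif_pos hj]
      exact h _ _ _ (mem_edges_component_iff.mpr hσ)
    · rintro ⟨ε, h⟩
      exact ⟨fun v => ε v, fun i j σ hσ => h i i.2 j σ (mem_edges_component_iff.mp hσ)⟩
  simp only [Balanced, BalancedOn, hhalf, hloop, hε, forall_and]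

end ComponentBalance

/-- Signed edges, halfedges and loops on the vertex set `V`. -/
abbrev Cell (V : Type*) := (Sym2 V × ℤˣ) ⊕ V ⊕ V

/-- The signed edges, halfedges and loops of `G`. -/
def cells {V : Type*} (G : SignedGraph V) : Set (Cell V) :=
  {x | Sum.elim (· ∈ G.edges) (Sum.elim (· ∈ G.half) (· ∈ G.loop)) x}

theorem ncard_cells {V : Type*} [Finite V] (G : SignedGraph V) :
    G.cells.ncard = G.edges.ncard + (G.half.ncard + G.loop.ncard) := by
  have h : G.cells = Sum.inl '' G.edges ∪
      (Sum.inr '' (Sum.inl '' G.half) ∪ Sum.inr '' (Sum.inr '' G.loop)) := by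
    ext (x | x | x) <;> simp [cells]
  have inj1 : Function.Injective (Sum.inl : Sym2 V × ℤˣ → Cell V) := Sum.inl_injective
  rw [h, Set.ncard_union_eq (by rw [Set.disjoint_left]; rintro _ ⟨x, -, rfl⟩; simp),
    Set.ncard_union_eq (by rw [Set.disjoint_left]; rintro _ ⟨_, ⟨x, -, rfl⟩, rfl⟩; simp),
    Set.ncard_image_of_injective _ Sum.inl_injective,
    Set.ncard_image_of_injective _ Sum.inr_injective,
    Set.ncard_image_of_injective _ Sum.inr_injective,
    Set.ncard_image_of_injective _ Sum.inl_injective,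
    Set.ncard_image_of_injective _ Sum.inr_injective]

section Lattice

variable {V : Type*} [Fintype V] [LinearOrder V] {G : SignedGraph V}

/-- The vector encoded by a signed edge, halfedge or loop. -/
def cellVec : Cell V → V → ℤ
  | .inl (p, σ) => Pi.single p.inf 1 - Pi.single p.sup (σ : ℤ)
  | .inr (.inl v) => Pi.single v 1
  | .inr (.inr v) => Pi.single v 2

/-- The lattice spanned by the vectors of `G`. -/
def lattice (G : SignedGraph V) : AddSubgroup (V → ℤ) :=
  AddSubgroup.closure (cellVec '' G.cells)

/-- The real subspace spanned by the vectors of `G`. -/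
noncomputable def realSpan (G : SignedGraph V) : Submodule ℝ (V → ℝ) :=
  Submodule.span ℝ ((fun e => latticeCast V (cellVec e)) '' G.cells)

omit [Fintype V] in
theorem cellVec_mk_of_le {i j : V} (h : i ≤ j) (σ : ℤˣ) :
    cellVec (.inl (s(i, j), σ)) = Pi.single i 1 - Pi.single j (σ : ℤ) := by
  simp [cellVec, h]

omit [Fintype V] in
theorem single_sub_single_mem_lattice {i j : V} {σ : ℤˣ} (h : (s(i, j), σ) ∈ G.edges) :
    (Pi.single i 1 - Pi.single j (σ : ℤ) : V → ℤ) ∈ G.lattice := by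
  have hcell : ∀ {e : Sym2 V × ℤˣ}, e ∈ G.edges → cellVec (.inl e) ∈ G.lattice := fun he =>
    AddSubgroup.subset_closure ⟨_, he, rfl⟩
  rcases le_total i j with hij | hij
  · rw [← cellVec_mk_of_le hij]
    exact hcell h
  · have h' := G.lattice.zsmul_mem (hcell (Sym2.eq_swap ▸ h)) (-(σ : ℤ))
    rw [cellVec_mk_of_le hij] at h'
    convert h' using 1
    rw [smul_sub, ← Pi.single_smul', ← Pi.single_smul']
    rcases Int.units_eq_one_or σ with rfl | rfl <;> simp [Pi.single_neg] <;> abel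

omit [Fintype V] in
theorem single_half_mem_lattice {v : V} (h : v ∈ G.half) :
    (Pi.single v 1 : V → ℤ) ∈ G.lattice :=
  AddSubgroup.subset_closure ⟨.inr (.inl v), h, rfl⟩

omit [Fintype V] in
theorem single_loop_mem_lattice {v : V} (h : v ∈ G.loop) :
    (Pi.single v 2 : V → ℤ) ∈ G.lattice :=
  AddSubgroup.subset_closure ⟨.inr (.inr v), h, rfl⟩

/-- The hypotheses say that the functional with coefficients `a` kills each generator. The ring is
arbitrary so as to cover `ℤ`, `ZMod 2` and `ℝ`; the condition `a v * 2 = 0` at loops is void modulo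
two. -/
theorem sum_mul_eq_zero_of_mem_cells {R : Type*} [CommRing R] {a : V → R}
    (hedge : ∀ i j σ, (s(i, j), σ) ∈ G.edges → a i = ((σ : ℤ) : R) * a j)
    (hhalf : ∀ v ∈ G.half, a v = 0) (hloop : ∀ v ∈ G.loop, a v * 2 = 0) {e : Cell V}
    (he : e ∈ G.cells) : ∑ v, a v * (cellVec e v : R) = 0 := by
  rcases e with ⟨p, σ⟩ | v | v
  · induction p using Sym2.ind with
    | _ i j =>
      have he' : (s(i, j), σ) ∈ G.edges := he
      have key : ∀ i j : V, i ≤ j → (s(i, j), σ) ∈ G.edges →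
          ∑ v, a v * (cellVec (.inl (s(i, j), σ)) v : R) = 0 := by
        intro i j hij he
        rw [cellVec_mk_of_le hij]
        simp only [Pi.sub_apply, Int.cast_sub, mul_sub, Finset.sum_sub_distrib, Pi.single_apply,
          apply_ite (Int.cast : ℤ → R), Int.cast_zero, mul_ite, mul_zero, Finset.sum_ite_eq',
          Finset.mem_univ, if_true, Int.cast_one, mul_one]
        rw [hedge i j σ he]
        ring
      rcases le_total i j with hij | hij
      · exact key i j hij he'
      · rw [Sym2.eq_swap] at he' ⊢
        exact key j i hij he'
  · have := hhalf v he
    simp [cellVec, Pi.single_apply, apply_ite (Int.cast : ℤ → R), this]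
  · have := hloop v he
    simp [cellVec, Pi.single_apply, apply_ite (Int.cast : ℤ → R), this]

theorem sum_mul_eq_zero_of_mem_lattice {R : Type*} [CommRing R] {a : V → R}
    (hedge : ∀ i j σ, (s(i, j), σ) ∈ G.edges → a i = ((σ : ℤ) : R) * a j)
    (hhalf : ∀ v ∈ G.half, a v = 0) (hloop : ∀ v ∈ G.loop, a v * 2 = 0) {x : V → ℤ}
    (hx : x ∈ G.lattice) : ∑ v, a v * (x v : R) = 0 := by
  induction hx using AddSubgroup.closure_induction with
  | mem x hx =>
    obtain ⟨e, he, rfl⟩ := hx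
    exact sum_mul_eq_zero_of_mem_cells hedge hhalf hloop he
  | zero => simp
  | add x y _ _ hx hy => simp [mul_add, Finset.sum_add_distrib, hx, hy]
  | neg x _ hx => simp [hx]

theorem sum_mul_eq_zero_of_mem_realSpan {a : V → ℝ}
    (hedge : ∀ i j σ, (s(i, j), σ) ∈ G.edges → a i = ((σ : ℤ) : ℝ) * a j)
    (hhalf : ∀ v ∈ G.half, a v = 0) (hloop : ∀ v ∈ G.loop, a v = 0) {y : V → ℝ}
    (hy : y ∈ G.realSpan) : ∑ v, a v * y v = 0 := by
  induction hy using Submodule.span_induction with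
  | mem x hx =>
    obtain ⟨e, he, rfl⟩ := hx
    exact sum_mul_eq_zero_of_mem_cells hedge hhalf (fun v hv => by rw [hloop v hv, zero_mul]) he
  | zero => simp
  | add x y _ _ hx hy => simp [mul_add, Finset.sum_add_distrib, hx, hy]
  | smul r x _ hx => simp [mul_left_comm _ r, ← Finset.mul_sum, hx]

omit [Fintype V] in
theorem latticeCast_mem_realSpan {x : V → ℤ} (hx : x ∈ G.lattice) :
    latticeCast V x ∈ G.realSpan :=
  map_mem_span_of_mem_closure (c := latticeCast V) hx

-- Edge vectors telescope along a walk: modulo the lattice, `e_j` is `e_i` times the product of the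
-- signs.
omit [Fintype V] in
theorem exists_single_sub_single_mem_lattice {i j : V} (h : G.underlying.Reachable i j) :
    ∃ η : ℤˣ, (Pi.single j 1 - Pi.single i (η : ℤ) : V → ℤ) ∈ G.lattice := by
  obtain ⟨w⟩ := h
  induction w with
  | nil => exact ⟨1, by simp⟩
  | @cons i k j hik _ ih =>
    obtain ⟨η, hη⟩ := ih
    obtain ⟨σ, hσ⟩ := underlying_adj_iff.mp hik
    refine ⟨η * σ, ?_⟩
    have h1 := single_sub_single_mem_lattice (Sym2.eq_swap ▸ hσ : (s(k, i), σ) ∈ G.edges)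
    have h2 := G.lattice.add_mem hη (G.lattice.zsmul_mem h1 (η : ℤ))
    convert h2 using 1
    rw [smul_sub, ← Pi.single_smul', ← Pi.single_smul']
    simp

omit [Fintype V] in
/-- In a part of a component in which twice the standard basis vectors do not belong to the
lattice, the signs that relate the basis vectors modulo the lattice switch all edges to positive
ones. -/
theorem sign_eq_of_single_two_notMem {r i j : V} {σ η θ : ℤˣ}
    (hr : (Pi.single r 2 : V → ℤ) ∉ G.lattice)
    (hi : (Pi.single i 1 - Pi.single r (η : ℤ) : V → ℤ) ∈ G.lattice)
    (hj : (Pi.single j 1 - Pi.single r (θ : ℤ) : V → ℤ) ∈ G.lattice)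
    (h : (s(i, j), σ) ∈ G.edges) : η = σ * θ := by
  have h1 := single_sub_single_mem_lattice h
  have h2 := G.lattice.sub_mem (G.lattice.sub_mem h1 hi)
    (G.lattice.zsmul_mem hj (-(σ : ℤ)))
  have h3 : (Pi.single i 1 - Pi.single j (σ : ℤ) - (Pi.single i 1 - Pi.single r (η : ℤ)) -
      (-(σ : ℤ)) • (Pi.single j 1 - Pi.single r (θ : ℤ)) : V → ℤ) =
      Pi.single r ((η : ℤ) - σ * θ) := by
    rw [smul_sub, ← Pi.single_smul', ← Pi.single_smul', Pi.single_sub]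
    simp only [smul_eq_mul, neg_mul, mul_one, Pi.single_neg]
    abel
  rw [h3] at h2
  -- If the signs differ, then `η - σθ` is `2` or `-2`, and `2 e_r` lies in the lattice after all.
  by_contra hne
  rcases Int.units_eq_one_or (σ * θ) with h' | h' <;> rcases Int.units_eq_one_or η with h'' | h''
  · exact hne (h''.trans h'.symm)
  · rw [← Units.val_mul, h', h''] at h2
    apply hr
    have := G.lattice.neg_mem h2
    rw [← Pi.single_neg] at this
    simpa using this
  · rw [← Units.val_mul, h', h''] at h2
    exact hr (by simpa using h2)
  · exact hne (h''.trans h'.symm)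

omit [Fintype V] in
theorem single_mem_lattice_of_related {r i : V} {η : ℤˣ}
    (hi : (Pi.single i 1 - Pi.single r (η : ℤ) : V → ℤ) ∈ G.lattice) {k : ℤ}
    (h : (Pi.single i k : V → ℤ) ∈ G.lattice) : (Pi.single r k : V → ℤ) ∈ G.lattice := by
  have h1 := G.lattice.sub_mem h (G.lattice.zsmul_mem hi k)
  have h2 := G.lattice.zsmul_mem h1 (η : ℤ)
  convert h2 using 1
  rw [smul_sub, smul_sub, smul_sub, ← Pi.single_smul', ← Pi.single_smul', ← Pi.single_smul',
    ← Pi.single_smul', ← Pi.single_smul']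
  rcases Int.units_eq_one_or η with rfl | rfl <;> simp

-- Modulo the lattice each `e_v` is a sign times `e_r`. These signs are a switching unless some edge
-- contradicts them, which yields `2 e_r`; a halfedge would yield `e_r` and a loop `2 e_r`.
omit [Fintype V] in
theorem balancedOn_of_single_two_notMem {r : V} {S : Set V}
    (hS : ∀ v ∈ S, G.underlying.Reachable r v)
    (hr : (Pi.single r 2 : V → ℤ) ∉ G.lattice) : G.BalancedOn S := by
  have hex : ∀ v, ∃ η : ℤˣ, G.underlying.Reachable r v →
      (Pi.single v 1 - Pi.single r (η : ℤ) : V → ℤ) ∈ G.lattice := by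
    intro v
    by_cases h : G.underlying.Reachable r v
    · obtain ⟨η, hη⟩ := exists_single_sub_single_mem_lattice h
      exact ⟨η, fun _ => hη⟩
    · exact ⟨1, fun h' => absurd h' h⟩
  choose η hη using hex
  refine ⟨⟨η, fun i hi j σ hσ => ?_⟩, fun v hv => ⟨fun h => hr ?_, fun h => hr ?_⟩⟩
  · have hj : G.underlying.Reachable r j :=
      (hS i hi).trans (underlying_adj_iff.mpr ⟨σ, hσ⟩).reachable
    exact sign_eq_of_single_two_notMem hr (hη i (hS i hi)) (hη j hj) hσ
  · have h1 := single_mem_lattice_of_related (hη v (hS v hv)) (single_half_mem_lattice h)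
    have h2 := G.lattice.add_mem h1 h1
    rwa [← Pi.single_add] at h2
  · exact single_mem_lattice_of_related (hη v (hS v hv)) (single_loop_mem_lattice h)

omit [Fintype V] in
/-- A connected unbalanced signed graph has at least as many edges, halfedges and loops as
vertices. -/
theorem Connected.card_le_ncard_cells [Finite V] (hG : G.Connected) (hb : ¬ G.Balanced) :
    Nat.card V ≤ G.cells.ncard := by
  cases nonempty_fintype V
  -- Since `G` is unbalanced, twice every basis vector lies in the lattice, so the vectors of `G`
  -- span the whole space.
  have htop : G.realSpan = ⊤ := by
    rw [eq_top_iff, ← (Pi.basisFun ℝ V).span_eq, Submodule.span_le]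
    rintro _ ⟨v, rfl⟩
    have h : (Pi.single v 2 : V → ℤ) ∈ G.lattice := by
      by_contra h
      exact hb (balanced_iff_balancedOn_univ.mpr
        (balancedOn_of_single_two_notMem (fun w _ => SimpleGraph.Connected.preconnected hG v w) h))
    have h2 := G.realSpan.smul_mem (1 / 2 : ℝ) (latticeCast_mem_realSpan h)
    have h3 : Pi.basisFun ℝ V v = (1 / 2 : ℝ) • latticeCast V (Pi.single v 2) := by
      ext w
      simp [Pi.single_apply, apply_ite (Int.cast : ℤ → ℝ)]
    rw [h3]
    exact h2
  have h1 : Module.finrank ℝ G.realSpan = Nat.card V := by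
    rw [htop, finrank_top, Module.finrank_fintype_fun_eq_card, Nat.card_eq_fintype_card]
  rw [← h1]
  have hfin : ((fun e => latticeCast V (cellVec e)) '' G.cells).Finite := Set.toFinite _
  have := hfin.fintype
  refine (finrank_span_le_card _).trans ?_
  rw [← Set.ncard_eq_toFinset_card']
  exact Set.ncard_image_le (Set.toFinite _)

end Lattice

end SignedGraph

/-! ### Trees, halfedge-trees, loop-trees and pseudotrees in terms of balance and edge counts -/

namespace SignedGraph

section Classification

variable {V : Type*} {G : SignedGraph V}

/-- Deleting an edge of a cycle would leave a connected graph with too few edges. -/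
theorem Connected.not_isCycle [Finite V] (hG : G.Connected)
    (hcard : G.edges.ncard + 1 = Nat.card V) (C : Set (Sym2 V × ℤˣ)) : ¬ G.IsCycle C := by
  intro hC
  obtain ⟨e, he⟩ := hC.nonempty
  have h1 := (hG.deleteEdge hC he).card_le_ncard_edges_add_one
  have h2 := ncard_edges_deleteEdge (hC.subset_edges he)
  omega

theorem existsUnique_mem_iff_ncard [Finite V] {S : Set V} : (∃! v, v ∈ S) ↔ S.ncard = 1 := by
  rw [Set.ncard_eq_one]
  constructor
  · rintro ⟨v, hv, h⟩
    exact ⟨v, Set.eq_singleton_iff_unique_mem.mpr ⟨hv, h⟩⟩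
  · rintro ⟨v, rfl⟩
    exact ⟨v, rfl, fun _ h => h⟩

theorem ncard_cells_deleteEdge [Finite V] {e : Sym2 V × ℤˣ} (he : e ∈ G.edges) :
    (G.deleteEdge e).cells.ncard + 1 = G.cells.ncard := by
  have h := ncard_edges_deleteEdge he
  have h1 : (G.deleteEdge e).half = G.half := rfl
  have h2 : (G.deleteEdge e).loop = G.loop := rfl
  rw [ncard_cells, ncard_cells, h1, h2]
  omega

variable [LinearOrder V]

/-- A tree is balanced because a connected unbalanced graph has at least as many cells as vertices.
-/
theorem isTree_iff [Finite V] : G.IsTree ↔ G.Connected ∧ G.Balanced ∧ G.cells.ncard + 1 = Nat.card V := by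
  constructor
  · rintro ⟨hc, hcyc, hh, hl⟩
    have h1 := hc.ncard_edges_of_forall_not_isCycle hcyc
    have h2 : G.cells.ncard + 1 = Nat.card V := by
      rw [ncard_cells, hh, hl]
      simpa using h1
    refine ⟨hc, ?_, h2⟩
    by_contra hb
    have := hc.card_le_ncard_cells hb
    omega
  · rintro ⟨hc, ⟨-, hh, hl⟩, hcard⟩
    refine ⟨hc, hc.not_isCycle ?_, hh, hl⟩
    rw [ncard_cells, hh, hl] at hcard
    simpa using hcard

omit [LinearOrder V] in
theorem IsPseudotree.not_balanced (h : G.IsPseudotree) : ¬ G.Balanced := by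
  rintro ⟨⟨ε, hε⟩, -⟩
  obtain ⟨-, ⟨C, hC, hCb, -⟩, -⟩ := h
  exact hCb (hε.isBalancedCycle hC)

omit [LinearOrder V] in
theorem IsPseudotree.ncard_cells [Finite V] (h : G.IsPseudotree) : G.cells.ncard = Nat.card V := by
  obtain ⟨hc, ⟨C, hC, -, huniq⟩, hh, hl⟩ := h
  obtain ⟨e, he⟩ := hC.nonempty
  have h1 := (hc.deleteEdge hC he).ncard_edges_of_forall_not_isCycle fun C' hC' => by
    rw [isCycle_deleteEdge_iff] at hC'
    exact hC'.2 (huniq C' hC'.1 ▸ he)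
  rw [ncard_edges_deleteEdge (hC.subset_edges he)] at h1
  rw [SignedGraph.ncard_cells, hh, hl]
  simpa using h1

/-- For the converse, deleting an edge of any cycle leaves a connected graph without cycles, so
every other cycle uses that edge too; hence there is only one cycle. Were it balanced, a switching
of the graph without one of its edges would extend to `G`. -/
theorem isPseudotree_iff [Finite V] : G.IsPseudotree ↔
    G.Connected ∧ ¬ G.Balanced ∧ G.cells.ncard = Nat.card V ∧ G.half = ∅ ∧ G.loop = ∅ := by
  refine ⟨fun h => ⟨h.1, h.not_balanced, h.ncard_cells, h.2.2⟩, ?_⟩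
  rintro ⟨hc, hb, hcard, hh, hl⟩
  have hedges : G.edges.ncard = Nat.card V := by
    rw [ncard_cells, hh, hl] at hcard
    simpa using hcard
  have hdel : ∀ {C : Set (Sym2 V × ℤˣ)}, G.IsCycle C → ∀ {e}, e ∈ C →
      (G.deleteEdge e).Connected ∧ (G.deleteEdge e).edges.ncard + 1 = Nat.card V :=
    fun hC _ he => ⟨hc.deleteEdge hC he, by rw [ncard_edges_deleteEdge (hC.subset_edges he), hedges]⟩
  have hsub : ∀ {C C' : Set (Sym2 V × ℤˣ)}, G.IsCycle C → G.IsCycle C' → C ⊆ C' := by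
    intro C C' hC hC' e he
    by_contra he'
    exact (hdel hC he).1.not_isCycle (hdel hC he).2 C' (isCycle_deleteEdge_iff.mpr ⟨hC', he'⟩)
  obtain ⟨C, hC⟩ : ∃ C, G.IsCycle C := by
    by_contra h
    have := hc.ncard_edges_of_forall_not_isCycle fun C hC => h ⟨C, hC⟩
    omega
  refine ⟨hc, ⟨C, hC, fun hCb => hb ⟨?_, hh, hl⟩, fun C' hC' =>
    (hsub hC' hC).antisymm (hsub hC hC')⟩, hh, hl⟩
  obtain ⟨e, he⟩ := hC.nonempty
  -- The graph without `e` is connected and has too few cells to be unbalanced.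
  have hbal : (G.deleteEdge e).Balanced := by
    by_contra hb'
    have h1 := (hdel hC he).1.card_le_ncard_cells hb'
    have h2 := ncard_cells_deleteEdge (hC.subset_edges he)
    omega
  obtain ⟨⟨ε, hε⟩, -⟩ := hbal
  exact ⟨ε, hε.of_deleteEdge hC hCb he⟩

-- At least `Nat.card V - 1` of the cells are edges, so a halfedge leaves no room for a second one,
-- for a loop or for a cycle.
omit [LinearOrder V] in
theorem isHalfedgeTree_iff [Finite V] : G.IsHalfedgeTree ↔
    G.Connected ∧ ¬ G.Balanced ∧ G.cells.ncard = Nat.card V ∧ G.half.Nonempty := by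
  constructor
  · rintro ⟨hc, hcyc, hh, hl⟩
    have hne : G.half.Nonempty := hh.exists
    refine ⟨hc, fun hb => hne.ne_empty hb.2.1, ?_, hne⟩
    rw [existsUnique_mem_iff_ncard] at hh
    rw [ncard_cells, hh, hl, Set.ncard_empty, ← hc.ncard_edges_of_forall_not_isCycle hcyc]
  · rintro ⟨hc, hb, hcard, hne⟩
    have h1 := hc.card_le_ncard_edges_add_one
    have h2 : 0 < G.half.ncard := (Set.ncard_pos (Set.toFinite _)).mpr hne
    rw [ncard_cells] at hcard
    refine ⟨hc, hc.not_isCycle (by omega), existsUnique_mem_iff_ncard.mpr (by omega), ?_⟩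
    rw [← Set.ncard_eq_zero (Set.toFinite _)]
    omega

omit [LinearOrder V] in
theorem isLoopTree_iff [Finite V] : G.IsLoopTree ↔
    G.Connected ∧ ¬ G.Balanced ∧ G.cells.ncard = Nat.card V ∧ G.half = ∅ ∧ G.loop.Nonempty := by
  constructor
  · rintro ⟨hc, hcyc, hh, hl⟩
    have hne : G.loop.Nonempty := hl.exists
    refine ⟨hc, fun hb => hne.ne_empty hb.2.2, ?_, hh, hne⟩
    rw [existsUnique_mem_iff_ncard] at hl
    rw [ncard_cells, hh, hl, Set.ncard_empty, ← hc.ncard_edges_of_forall_not_isCycle hcyc]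
  · rintro ⟨hc, hb, hcard, hh, hne⟩
    have h1 := hc.card_le_ncard_edges_add_one
    have h2 : 0 < G.loop.ncard := (Set.ncard_pos (Set.toFinite _)).mpr hne
    rw [ncard_cells, hh, Set.ncard_empty] at hcard
    exact ⟨hc, hc.not_isCycle (by omega), hh, existsUnique_mem_iff_ncard.mpr (by omega)⟩

open Classical in
theorem Connected.card_le [Finite V] (hG : G.Connected) :
    Nat.card V ≤ G.cells.ncard + if G.Balanced then 1 else 0 := by
  split_ifs with h
  · refine hG.card_le_ncard_edges_add_one.trans (Nat.add_le_add_right ?_ 1)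
    rw [ncard_cells]
    exact Nat.le_add_right _ _
  · exact hG.card_le_ncard_cells h

-- The four kinds are exactly the equality cases of `Connected.card_le`; balance, halfedges and
-- loops tell them apart.
open Classical in
theorem Connected.isTree_or_iff [Finite V] (hG : G.Connected) :
    (G.IsTree ∨ G.IsHalfedgeTree ∨ G.IsLoopTree ∨ G.IsPseudotree) ↔
      G.cells.ncard + (if G.Balanced then 1 else 0) = Nat.card V := by
  rw [isTree_iff, isHalfedgeTree_iff, isLoopTree_iff, isPseudotree_iff]
  rcases Set.eq_empty_or_nonempty G.half with hh | hh <;>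
    rcases Set.eq_empty_or_nonempty G.loop with hl | hl <;>
    by_cases hb : G.Balanced <;>
    simp_all [Set.nonempty_iff_ne_empty]

end Classification

theorem component_connected {V : Type*} {G : SignedGraph V} (c : G.underlying.ConnectedComponent) :
    (G.component c).Connected := by
  have h : (G.component c).underlying = c.toSimpleGraph := by
    ext i j
    rfl
  rw [Connected, h]
  exact c.connected_toSimpleGraph

end SignedGraph

/-! ### The lattice of a signed graph in terms of its components -/

namespace SignedGraph

/-! ### Signed sums over components -/

section Signing

variable {V : Type*} {G : SignedGraph V}

/-- A chosen vertex of a component. -/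
noncomputable def rootOf (c : G.underlying.ConnectedComponent) : V := Quot.out c

@[simp]
theorem mk_rootOf (c : G.underlying.ConnectedComponent) :
    G.underlying.connectedComponentMk (rootOf c) = c := Quot.out_eq c

/-- The chosen vertex of the component of `v`. -/
noncomputable def root (G : SignedGraph V) (v : V) : V :=
  rootOf (G.underlying.connectedComponentMk v)

theorem rootOf_reachable {c : G.underlying.ConnectedComponent} {v : V}
    (hv : G.underlying.connectedComponentMk v = c) : G.underlying.Reachable (rootOf c) v :=
  SimpleGraph.ConnectedComponent.exact ((mk_rootOf c).trans hv.symm)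

open Classical in
/-- The signs `ε` restricted to the component `c`. -/
noncomputable def compSign (ε : V → ℤˣ) (c : G.underlying.ConnectedComponent) (R : Type*)
    [CommRing R] (v : V) : R :=
  if G.underlying.connectedComponentMk v = c then ((ε v : ℤ) : R) else 0

theorem intCast_compSign (ε : V → ℤˣ) (c : G.underlying.ConnectedComponent) (R : Type*)
    [CommRing R] (v : V) : ((compSign ε c ℤ v : ℤ) : R) = compSign ε c R v := by
  rw [compSign, compSign]
  split_ifs <;> simp

/-- Signs that relate all basis vectors of a component modulo the lattice, and that switch the
edges of balanced components to positive ones. -/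
structure IsSigning [LinearOrder V] (G : SignedGraph V) (ε : V → ℤˣ) : Prop where
  related : ∀ v, (Pi.single v 1 - Pi.single (G.root v) (ε v : ℤ) : V → ℤ) ∈ G.lattice
  switches : ∀ i j σ, (s(i, j), σ) ∈ G.edges →
    (G.component (G.underlying.connectedComponentMk i)).Balanced → ε i = σ * ε j

theorem compSign_edge {ε : V → ℤˣ} {c : G.underlying.ConnectedComponent} {R : Type*} [CommRing R]
    (h : ∀ i j σ, (s(i, j), σ) ∈ G.edges → G.underlying.connectedComponentMk i = c →
      ε i = σ * ε j) (i j : V) (σ : ℤˣ) (hσ : (s(i, j), σ) ∈ G.edges) :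
    compSign ε c R i = ((σ : ℤ) : R) * compSign ε c R j := by
  rw [compSign, compSign, ← connectedComponentMk_eq_of_mem_edges hσ]
  split_ifs with hi
  · rw [h i j σ hσ hi]
    simp
  · simp

theorem compSign_of_notMem {ε : V → ℤˣ} {c : G.underlying.ConnectedComponent} {R : Type*}
    [CommRing R] {S : Set V} (h : ∀ v ∈ c.supp, v ∉ S) : ∀ v ∈ S, compSign ε c R v = 0 :=
  fun _ hv => if_neg fun hc => h _ hc hv

theorem compSign_zmod_two (ε : V → ℤˣ) (c : G.underlying.ConnectedComponent) (v : V) :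
    compSign ε c (ZMod 2) v = compSign 1 c (ZMod 2) v := by
  rw [compSign, compSign]
  rcases Int.units_eq_one_or (ε v) with h | h <;> simp [h]

theorem forall_half_notMem_iff {c : G.underlying.ConnectedComponent} :
    (G.component c).half = ∅ ↔ ∀ v ∈ c.supp, v ∉ G.half := by
  rw [Set.eq_empty_iff_forall_notMem]
  exact ⟨fun h v hv => h ⟨v, hv⟩, fun h v => h v v.2⟩

variable [Fintype V]

/-- Signs are invisible modulo two, so the parity of the signed sum is a functional that is defined
without any switching. -/
theorem even_sum_compSign_iff (ε : V → ℤˣ) (c : G.underlying.ConnectedComponent) (x : V → ℤ) :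
    Even (∑ v, compSign ε c ℤ v * x v) ↔ ∑ v, compSign 1 c (ZMod 2) v * (x v : ZMod 2) = 0 := by
  rw [even_iff_two_dvd, show (2 : ℤ) = ((2 : ℕ) : ℤ) from rfl, ← ZMod.intCast_zmod_eq_zero_iff_dvd _ 2]
  simp [intCast_compSign, compSign_zmod_two ε]

theorem even_sum_compSign_one_iff (ε : V → ℤˣ) (c : G.underlying.ConnectedComponent) :
    Even (∑ v, compSign ε c ℤ v) ↔ Even c.supp.ncard := by
  classical
  have h := even_sum_compSign_iff ε c 1
  simp only [Pi.one_apply, mul_one, Int.cast_one] at h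
  rw [h, ← ZMod.natCast_eq_zero_iff_even, Set.ncard_eq_toFinset_card']
  simp only [compSign, Pi.one_apply, Units.val_one, Int.cast_one, Finset.sum_boole]
  have e : c.supp.toFinset = Finset.univ.filter fun v => G.underlying.connectedComponentMk v = c := by
    ext v
    simp
  rw [e]

/-- The vector supported on the chosen vertices with prescribed signed sums over the components. -/
theorem exists_sum_compSign_eq {R : Type*} [CommRing R] (ε : V → ℤˣ)
    (z : G.underlying.ConnectedComponent → R) :
    ∃ y : V → R, ∀ c, ∑ v, compSign ε c R v * y v = z c := by
  classical
  refine ⟨fun v => if v = G.root v then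
    ((ε v : ℤ) : R) * z (G.underlying.connectedComponentMk v) else 0, fun c => ?_⟩
  rw [Finset.sum_eq_single (rootOf c)]
  · have hr : rootOf c = G.root (rootOf c) := by rw [root, mk_rootOf]
    simp only
    rw [if_pos hr, compSign, if_pos (mk_rootOf c), mk_rootOf, ← mul_assoc,
      ← Int.cast_mul, ← Units.val_mul, Int.units_mul_self]
    simp
  · intro v _ hv
    simp only [compSign]
    split_ifs with h1 h2
    · exact absurd (h2.trans (by rw [root, h1])) hv
    · simp
    · simp
    · simp
  · simp

/-- Each coordinate is moved to the chosen vertex of its component, where the signed sum of the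
component collects. This reduces membership questions to multiples of the basis vectors at the
chosen vertices, over `ℤ` and over `ℝ`. -/
theorem eq_sum_smul_add_sum_single [DecidableEq V] {R : Type*} [CommRing R] (ε : V → ℤˣ)
    (x : V → R) :
    x = ∑ v, x v • (Pi.single v 1 - Pi.single (G.root v) ((ε v : ℤ) : R)) +
      ∑ u, Pi.single u (if u = G.root u then
        ∑ v, compSign ε (G.underlying.connectedComponentMk u) R v * x v else 0) := by
  classical
  have h : ∀ u, (if u = G.root u then
      ∑ v, compSign ε (G.underlying.connectedComponentMk u) R v * x v else 0) =
      ∑ v, if u = G.root v then ((ε v : ℤ) : R) * x v else 0 := by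
    intro u
    split_ifs with hu
    · refine Finset.sum_congr rfl fun v _ => ?_
      have : G.underlying.connectedComponentMk v = G.underlying.connectedComponentMk u ↔
          u = G.root v := by
        constructor
        · intro h
          rw [hu, root, root, h]
        · intro h
          rw [h, root, mk_rootOf]
      rw [compSign, ite_mul, zero_mul]
      simp only [this]
    · refine (Finset.sum_eq_zero fun v _ => if_neg fun h => hu ?_).symm
      have h' : G.underlying.connectedComponentMk u = G.underlying.connectedComponentMk v := by
        rw [h, root, mk_rootOf]
      rw [root, h', ← root]
      exact h
  ext w
  simp only [h, Pi.add_apply, Finset.sum_apply, Pi.smul_apply, Pi.sub_apply, smul_eq_mul, mul_sub,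
    Finset.sum_sub_distrib, Pi.single_apply]
  simp [mul_comm]

end Signing

/-! ### Membership, rank and index of the lattice -/

section LatticeDescription

variable {V : Type*} [Fintype V] [LinearOrder V] {G : SignedGraph V}

omit [Fintype V] in
theorem single_two_mem_lattice_of_not_balanced {c : G.underlying.ConnectedComponent}
    (hc : ¬ (G.component c).Balanced) : (Pi.single (rootOf c) 2 : V → ℤ) ∈ G.lattice := by
  by_contra h
  exact hc (component_balanced_iff.mpr
    (balancedOn_of_single_two_notMem (fun _ hv => rootOf_reachable hv) h))

/-- The switched sum over a balanced component vanishes on the lattice, but equals `2` or `-2` on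
this vector. -/
theorem single_two_notMem_lattice_of_balanced {c : G.underlying.ConnectedComponent}
    (hc : (G.component c).Balanced) : (Pi.single (rootOf c) 2 : V → ℤ) ∉ G.lattice := by
  intro h
  obtain ⟨⟨ε, hε⟩, hn⟩ := component_balanced_iff.mp hc
  have h0 := sum_mul_eq_zero_of_mem_lattice (R := ℤ) (a := compSign ε c ℤ)
    (compSign_edge fun i j σ hσ hi => hε i hi j σ hσ)
    (compSign_of_notMem fun v hv => (hn v hv).1)
    (fun v hv => by rw [compSign_of_notMem (fun v hv => (hn v hv).2) v hv, zero_mul]) h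
  simp [Pi.single_apply, compSign] at h0

/-- The signs obtained along walks switch balanced components automatically, because there twice the
basis vector at the chosen vertex is not in the lattice. -/
theorem exists_isSigning (G : SignedGraph V) : ∃ ε, G.IsSigning ε := by
  have hex := fun v => exists_single_sub_single_mem_lattice (G := G)
    (rootOf_reachable (rfl : G.underlying.connectedComponentMk v = _))
  choose ε hε using hex
  refine ⟨ε, hε, fun i j σ hσ hb => ?_⟩
  have hij := connectedComponentMk_eq_of_mem_edges hσ
  refine sign_eq_of_single_two_notMem (single_two_notMem_lattice_of_balanced hb) (hε i) ?_ hσ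
  rw [hij]
  exact hε j

variable {ε : V → ℤˣ}

/-- The conditions are necessary since the signed sums over `ℤ`, or modulo two, kill the generators.
Conversely, `x` reduces to a multiple of `e_r` for each chosen vertex `r`; the multiple is zero in a
balanced component, `2 e_r` is available in an unbalanced one, and `e_r` itself if there is a
halfedge. -/
theorem IsSigning.mem_lattice_iff (hε : G.IsSigning ε) {x : V → ℤ} :
    x ∈ G.lattice ↔
      (∀ c, (G.component c).Balanced → ∑ v, compSign ε c ℤ v * x v = 0) ∧
      (∀ c, ¬ (G.component c).Balanced → (G.component c).half = ∅ →
        Even (∑ v, compSign ε c ℤ v * x v)) := by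
  constructor
  · intro hx
    constructor
    · intro c hc
      obtain ⟨-, hn⟩ := component_balanced_iff.mp hc
      exact sum_mul_eq_zero_of_mem_lattice (R := ℤ) (a := compSign ε c ℤ)
        (compSign_edge fun i j σ hσ hi => hε.switches i j σ hσ (hi ▸ hc))
        (compSign_of_notMem fun v hv => (hn v hv).1)
        (fun v hv => by rw [compSign_of_notMem (fun v hv => (hn v hv).2) v hv, zero_mul]) hx
    · intro c _ hh
      rw [even_sum_compSign_iff]
      refine sum_mul_eq_zero_of_mem_lattice (fun i j σ hσ => ?_)
        (compSign_of_notMem (forall_half_notMem_iff.mp hh)) (fun v _ => ?_) hx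
      · rw [compSign, compSign, connectedComponentMk_eq_of_mem_edges hσ]
        rcases Int.units_eq_one_or σ with rfl | rfl <;> simp
      · rw [show (2 : ZMod 2) = 0 from rfl, mul_zero]
  · rintro ⟨h1, h2⟩
    rw [eq_sum_smul_add_sum_single (G := G) ε x]
    refine add_mem (sum_mem fun v _ => ?_) (sum_mem fun u _ => ?_)
    · exact G.lattice.zsmul_mem (by simpa using hε.related v) _
    · split_ifs with hu
      · set c := G.underlying.connectedComponentMk u with hc
        by_cases hb : (G.component c).Balanced
        · rw [h1 c hb, Pi.single_zero]
          exact zero_mem _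
        · have hu' : u = rootOf c := hu
          by_cases hh : (G.component c).half = ∅
          · obtain ⟨k, hk⟩ := h2 c hb hh
            have h3 := G.lattice.zsmul_mem (single_two_mem_lattice_of_not_balanced hb) k
            rw [← Pi.single_smul', smul_eq_mul, mul_two, ← hk, ← hu'] at h3
            exact h3
          · obtain ⟨v, hv⟩ := Set.nonempty_iff_ne_empty.mpr hh
            have hv2 : G.root v = u := by
              rw [root, hu', v.2]
            have h3 := hε.related v
            rw [hv2] at h3
            have h4 := G.lattice.zsmul_mem
              (single_mem_lattice_of_related h3 (single_half_mem_lattice hv))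
              (∑ v, compSign ε c ℤ v * x v)
            rw [← Pi.single_smul', smul_eq_mul, mul_one] at h4
            exact h4
      · rw [Pi.single_zero]
        exact zero_mem _

theorem IsSigning.mem_realSpan_iff (hε : G.IsSigning ε) {y : V → ℝ} :
    y ∈ G.realSpan ↔
      ∀ c, (G.component c).Balanced → ∑ v, compSign ε c ℝ v * y v = 0 := by
  constructor
  · intro hy c hc
    obtain ⟨-, hn⟩ := component_balanced_iff.mp hc
    exact sum_mul_eq_zero_of_mem_realSpan
      (compSign_edge fun i j σ hσ hi => hε.switches i j σ hσ (hi ▸ hc))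
      (compSign_of_notMem fun v hv => (hn v hv).1)
      (compSign_of_notMem fun v hv => (hn v hv).2) hy
  · intro h
    rw [eq_sum_smul_add_sum_single (G := G) ε y]
    refine add_mem (sum_mem fun v _ => ?_) (sum_mem fun u _ => ?_)
    · have h1 := latticeCast_mem_realSpan (hε.related v)
      refine G.realSpan.smul_mem _ ?_
      convert h1 using 1
      ext w
      simp [Pi.single_apply, apply_ite (Int.cast : ℤ → ℝ)]
    · split_ifs with hu
      · set c := G.underlying.connectedComponentMk u with hc
        by_cases hb : (G.component c).Balanced
        · rw [h c hb, Pi.single_zero]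
          exact zero_mem _
        · have h1 := latticeCast_mem_realSpan (single_two_mem_lattice_of_not_balanced hb)
          have h2 := G.realSpan.smul_mem ((∑ v, compSign ε c ℝ v * y v) / 2) h1
          convert h2 using 1
          have hu' : u = rootOf c := hu
          rw [← hu']
          ext w
          simp [Pi.single_apply, apply_ite (Int.cast : ℤ → ℝ)]
      · rw [Pi.single_zero]
        exact zero_mem _

/-- Rank-nullity for the signed sums over balanced components: the span is their common kernel, and
they take arbitrary values. -/
theorem finrank_realSpan (G : SignedGraph V) :
    Module.finrank ℝ G.realSpan + {c | (G.component c).Balanced}.ncard = Nat.card V := by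
  classical
  obtain ⟨ε, hε⟩ := G.exists_isSigning
  let Ψ : (V → ℝ) →ₗ[ℝ] ({c | (G.component c).Balanced} → ℝ) :=
    Matrix.mulVecLin (Matrix.of fun c v => compSign ε (c : G.underlying.ConnectedComponent) ℝ v)
  have hΨ : ∀ y c, Ψ y c = ∑ v, compSign ε (c : G.underlying.ConnectedComponent) ℝ v * y v :=
    fun _ _ => rfl
  have hker : Ψ.ker = G.realSpan := by
    ext y
    rw [hε.mem_realSpan_iff, LinearMap.mem_ker, funext_iff]
    exact ⟨fun h c hc => h ⟨c, hc⟩, fun h c => h c c.2⟩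
  have hsurj : Function.Surjective Ψ := by
    intro z
    obtain ⟨y, hy⟩ := exists_sum_compSign_eq (G := G) ε
      fun c => if hc : (G.component c).Balanced then z ⟨c, hc⟩ else 0
    refine ⟨y, funext fun c => ?_⟩
    rw [hΨ, hy, dif_pos (show (G.component c).Balanced from c.2)]
  have hfin : Fintype {c | (G.component c).Balanced} := Fintype.ofFinite _
  have h := Ψ.finrank_range_add_finrank_ker
  rw [hker, LinearMap.range_eq_top.mpr hsurj, finrank_top, Module.finrank_fintype_fun_eq_card,
    Module.finrank_fintype_fun_eq_card] at h
  rw [Nat.card_eq_fintype_card, ← h, add_comm, ← Nat.card_coe_set_eq, Nat.card_eq_fintype_card]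

/-- Inside the saturated lattice `M` of the span, `G.lattice` is cut out by the parities of the
signed sums over the components in `U`, and these parities are arbitrary on `M`. -/
theorem relIndex_lattice (G : SignedGraph V) :
    G.lattice.relIndex (G.realSpan.toAddSubgroup.comap (latticeCast V)) =
      2 ^ {c | ¬ (G.component c).Balanced ∧ (G.component c).half = ∅}.ncard := by
  classical
  obtain ⟨ε, hε⟩ := G.exists_isSigning
  set U := {c | ¬ (G.component c).Balanced ∧ (G.component c).half = ∅} with hU
  set M := G.realSpan.toAddSubgroup.comap (latticeCast V) with hM
  have hmemM : ∀ x, x ∈ M ↔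
      ∀ c, (G.component c).Balanced → ∑ v, compSign ε c ℤ v * x v = 0 := by
    intro x
    change latticeCast V x ∈ G.realSpan ↔ _
    rw [hε.mem_realSpan_iff]
    refine forall₂_congr fun c _ => ?_
    rw [← Int.cast_eq_zero (α := ℝ)]
    simp [intCast_compSign]
  let ψ : (V → ℤ) →+ (U → ZMod 2) :=
    { toFun := fun x c => ((∑ v, compSign ε (c : G.underlying.ConnectedComponent) ℤ v * x v : ℤ) :
        ZMod 2)
      map_zero' := by ext; simp
      map_add' := fun x y => by ext; simp [mul_add, Finset.sum_add_distrib] }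
  have hψ : ∀ x c, ψ x c =
      ((∑ v, compSign ε (c : G.underlying.ConnectedComponent) ℤ v * x v : ℤ) : ZMod 2) :=
    fun _ _ => rfl
  have hL : G.lattice = ψ.ker ⊓ M := by
    ext x
    rw [hε.mem_lattice_iff, AddSubgroup.mem_inf, hmemM, AddMonoidHom.mem_ker, funext_iff, and_comm]
    refine and_congr ?_ Iff.rfl
    constructor
    · intro h c
      rw [hψ]
      exact (ZMod.intCast_zmod_eq_zero_iff_dvd _ 2).mpr (h c c.2.1 c.2.2).two_dvd
    · intro h c hb hh
      have := h ⟨c, hb, hh⟩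
      rw [hψ] at this
      exact even_iff_two_dvd.mpr ((ZMod.intCast_zmod_eq_zero_iff_dvd _ 2).mp this)
  have hmap : M.map ψ = ⊤ := by
    rw [eq_top_iff]
    rintro z -
    obtain ⟨y, hy⟩ := exists_sum_compSign_eq (G := G) (R := ℤ) ε
      fun c => if hc : c ∈ U then ((z ⟨c, hc⟩).val : ℤ) else 0
    refine ⟨y, (hmemM y).mpr fun c hc => ?_, funext fun c => ?_⟩
    · rw [hy, dif_neg fun h : c ∈ U => h.1 hc]
    · rw [hψ, hy, dif_pos c.2]
      simp
  rw [hL, AddSubgroup.inf_relIndex_right, AddSubgroup.relIndex_ker, hmap,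
    Nat.card_congr AddSubgroup.topEquiv.toEquiv, Nat.card_fun, Nat.card_zmod, Nat.card_coe_set_eq]

/-- A translate of the span of a signed graph by a vector in `(ℤ + 1/2)ⁿ` contains a lattice point
if and only if all balanced components have an even number of vertices. -/
theorem exists_latticeCast_sub_mem_realSpan_iff {w : V → ℝ} {k : V → ℤ}
    (hw : ∀ v, w v = k v + 1 / 2) :
    (∃ x, latticeCast V x - w ∈ G.realSpan) ↔
      ∀ c, (G.component c).Balanced → Even c.supp.ncard := by
  obtain ⟨ε, hε⟩ := G.exists_isSigning
  -- The half-integral part of `w` contributes half the sum of the signs, and that sum has the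
  -- parity of the number of vertices of the component.
  have key : ∀ (x : V → ℤ) (c : G.underlying.ConnectedComponent),
      ∑ v, compSign ε c ℝ v * (latticeCast V x - w) v = 0 ↔
        ∑ v, compSign ε c ℤ v = 2 * ∑ v, compSign ε c ℤ v * (x v - k v) := by
    intro x c
    rw [← Int.cast_inj (α := ℝ)]
    push_cast
    simp only [intCast_compSign, Pi.sub_apply, latticeCast_apply, hw, ← sub_sub, mul_sub _ _ (1 / 2 : ℝ),
      Finset.sum_sub_distrib _ (fun v => compSign ε c ℝ v * (1 / 2 : ℝ)), ← Finset.sum_mul]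
    constructor <;> intro h <;> linarith
  simp only [hε.mem_realSpan_iff, key, ← even_sum_compSign_one_iff ε]
  constructor
  · rintro ⟨x, hx⟩ c hc
    rw [hx c hc]
    exact even_two_mul _
  · intro h
    have h' : ∀ c : G.underlying.ConnectedComponent, ∃ z : ℤ, (G.component c).Balanced →
        ∑ v, compSign ε c ℤ v = 2 * z := by
      intro c
      by_cases hc : (G.component c).Balanced
      · obtain ⟨z, hz⟩ := h c hc
        exact ⟨z, fun _ => by rw [hz, two_mul]⟩
      · exact ⟨0, fun h => absurd h hc⟩
    choose z hz using h'
    obtain ⟨y, hy⟩ := exists_sum_compSign_eq (G := G) ε z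
    refine ⟨k + y, fun c hc => ?_⟩
    simp only [Pi.add_apply, add_sub_cancel_left, hy]
    exact hz c hc

end LatticeDescription

end SignedGraph

/-! ### Linear independence and pseudoforests -/

theorem Set.ncard_eq_sum_ncard_fiber {α β : Type*} [Finite α] [Fintype β] (f : α → β) (S : Set α) :
    S.ncard = ∑ b, {a ∈ S | f a = b}.ncard := by
  classical
  have := Fintype.ofFinite α
  rw [Set.ncard_eq_toFinset_card', Finset.card_eq_sum_card_fiberwise (f := f) (t := Finset.univ)
    (fun _ _ => Finset.mem_coe.mpr (Finset.mem_univ _))]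
  refine Finset.sum_congr rfl fun b _ => ?_
  rw [Set.ncard_eq_toFinset_card']
  congr 1
  ext a
  simp

namespace SignedGraph

section Pseudoforest

variable {V : Type*} [Fintype V] [LinearOrder V] {G : SignedGraph V}

omit [Fintype V] in
theorem ncard_cells_component [Finite V] (c : G.underlying.ConnectedComponent) :
    {e ∈ G.cells | Sum.elim (fun p : Sym2 V × ℤˣ => G.underlying.connectedComponentMk p.1.inf)
      (Sum.elim G.underlying.connectedComponentMk G.underlying.connectedComponentMk) e = c}.ncard =
      (G.component c).cells.ncard := by
  have hinj : Function.Injective (Sum.map (Prod.map (Sym2.map Subtype.val) id)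
      (Sum.map Subtype.val Subtype.val) : Cell c.supp → Cell V) :=
    Sum.map_injective.mpr ⟨(Sym2.map.injective Subtype.val_injective).prodMap
      Function.injective_id, Sum.map_injective.mpr ⟨Subtype.val_injective, Subtype.val_injective⟩⟩
  rw [← Set.ncard_image_of_injective _ hinj]
  congr 1
  ext e
  constructor
  · rintro ⟨he, hc⟩
    rcases e with ⟨p, σ⟩ | v | v
    · induction p using Sym2.ind with
      | _ i j =>
        have hij := connectedComponentMk_eq_of_mem_edges (show (s(i, j), σ) ∈ G.edges from he)
        have hi : i ∈ c.supp := by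
          rw [SimpleGraph.ConnectedComponent.mem_supp_iff, ← hc]
          rcases le_total i j with h | h
          · simp [h]
          · simp [h, hij]
        have hj : j ∈ c.supp := by
          rw [SimpleGraph.ConnectedComponent.mem_supp_iff] at hi ⊢
          rw [← hij, hi]
        exact ⟨.inl (s(⟨i, hi⟩, ⟨j, hj⟩), σ), mem_edges_component_iff.mpr he, rfl⟩
    · exact ⟨.inr (.inl ⟨v, hc⟩), he, rfl⟩
    · exact ⟨.inr (.inr ⟨v, hc⟩), he, rfl⟩
  · rintro ⟨e, he, rfl⟩
    rcases e with ⟨p, σ⟩ | v | v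
    · induction p using Sym2.ind with
      | _ i j =>
        refine ⟨mem_edges_component_iff.mp he, ?_⟩
        rcases le_total i j with h | h
        · have h' : (i : V) ≤ j := h
          simpa [h'] using (show G.underlying.connectedComponentMk (i : V) = c from i.2)
        · have h' : (j : V) ≤ i := h
          simpa [h'] using (show G.underlying.connectedComponentMk (j : V) = c from j.2)
    · exact ⟨he, v.2⟩
    · exact ⟨he, v.2⟩

omit [Fintype V] in
theorem linearIndepOn_cells_iff_ncard [Finite V] :
    LinearIndepOn ℝ (fun e => latticeCast V (cellVec e)) G.cells ↔
      G.cells.ncard = Module.finrank ℝ G.realSpan := by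
  have : Fintype G.cells := Fintype.ofFinite _
  rw [LinearIndepOn, linearIndependent_iff_card_eq_finrank_span, Set.finrank,
    ← Nat.card_eq_fintype_card, Nat.card_coe_set_eq, realSpan, Set.image_eq_range]

/-- The vectors of a signed graph are linearly independent if and only if it is a pseudoforest. -/
theorem linearIndepOn_cells_iff :
    LinearIndepOn ℝ (fun e => latticeCast V (cellVec e)) G.cells ↔ G.IsPseudoforest := by
  classical
  have : Fintype G.underlying.ConnectedComponent := Fintype.ofFinite _
  have h2 := G.finrank_realSpan
  have h3 : {c | (G.component c).Balanced}.ncard =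
      ∑ c, if (G.component c).Balanced then 1 else 0 := by
    rw [Finset.sum_boole, Set.ncard_eq_toFinset_card']
    simp
  have h4 : G.cells.ncard = ∑ c, (G.component c).cells.ncard := by
    rw [Set.ncard_eq_sum_ncard_fiber (Sum.elim (fun p : Sym2 V × ℤˣ =>
      G.underlying.connectedComponentMk p.1.inf)
      (Sum.elim G.underlying.connectedComponentMk G.underlying.connectedComponentMk))]
    exact Finset.sum_congr rfl fun c _ => ncard_cells_component c
  have h5 : Nat.card V = ∑ c : G.underlying.ConnectedComponent, Nat.card c.supp := by
    rw [← Set.ncard_univ, Set.ncard_eq_sum_ncard_fiber G.underlying.connectedComponentMk]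
    refine Finset.sum_congr rfl fun c _ => ?_
    rw [Nat.card_coe_set_eq]
    congr 1
    ext v
    simp
  have h6 : G.cells.ncard = Module.finrank ℝ G.realSpan ↔
      ∑ c : G.underlying.ConnectedComponent, Nat.card c.supp =
        ∑ c, ((G.component c).cells.ncard + if (G.component c).Balanced then 1 else 0) := by
    rw [Finset.sum_add_distrib, ← h3, ← h4, ← h5]
    omega
  -- Each summand satisfies the inequality `Connected.card_le`, so equality of the sums is equality
  -- in every component.
  rw [linearIndepOn_cells_iff_ncard, h6, Finset.sum_eq_sum_iff_of_le fun c _ => (component_connected c).card_le]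
  refine ⟨fun h c => (component_connected c).isTree_or_iff.mpr (h c (Finset.mem_univ c)).symm,
    fun h c _ => ((component_connected c).isTree_or_iff.mp (h c)).symm⟩

theorem IsPseudoforest.component_isTree_iff (hG : G.IsPseudoforest)
    (c : G.underlying.ConnectedComponent) :
    (G.component c).IsTree ↔ (G.component c).Balanced := by
  refine ⟨fun h => (isTree_iff.mp h).2.1, fun hb => ?_⟩
  rcases hG c with h | h | h | h
  · exact h
  · exact absurd hb (isHalfedgeTree_iff.mp h).2.1
  · exact absurd hb (isLoopTree_iff.mp h).2.1
  · exact absurd hb (isPseudotree_iff.mp h).2.1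

theorem IsPseudoforest.tc_eq (hG : G.IsPseudoforest) :
    G.tc = {c | (G.component c).Balanced}.ncard := by
  simp only [tc, hG.component_isTree_iff]

theorem IsPseudoforest.ncard_cells (hG : G.IsPseudoforest) :
    G.cells.ncard = Nat.card V - G.tc := by
  have h1 := linearIndepOn_cells_iff_ncard.mp (linearIndepOn_cells_iff.mpr hG)
  have h2 := G.finrank_realSpan
  rw [hG.tc_eq]
  omega

/-- This identifies the exponent of two in `relIndex_lattice`. -/
theorem IsPseudoforest.pc_add_lc (hG : G.IsPseudoforest) :
    G.pc + G.lc = {c | ¬ (G.component c).Balanced ∧ (G.component c).half = ∅}.ncard := by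
  rw [pc, lc, ← Set.ncard_union_eq]
  · congr 1
    ext c
    constructor
    · rintro (h | h)
      · have h' := isPseudotree_iff.mp h
        exact ⟨h'.2.1, h'.2.2.2.1⟩
      · have h' := isLoopTree_iff.mp h
        exact ⟨h'.2.1, h'.2.2.2.1⟩
    · rintro ⟨hb, hh⟩
      rcases hG c with h | h | h | h
      · exact absurd (isTree_iff.mp h).2.1 hb
      · exact absurd hh (isHalfedgeTree_iff.mp h).2.2.2.ne_empty
      · exact Or.inr h
      · exact Or.inl h
  · rw [Set.disjoint_left]
    intro c h1 h2
    exact (isLoopTree_iff.mp h2).2.2.2.2.ne_empty (isPseudotree_iff.mp h1).2.2.2.2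

omit [LinearOrder V] in
theorem lc_eq_zero (h : G.loop = ∅) : G.lc = 0 := by
  rw [lc, Set.ncard_eq_zero (Set.toFinite _), Set.eq_empty_iff_forall_notMem]
  rintro c ⟨-, -, -, v, hv, -⟩
  have hv' : (v : V) ∈ G.loop := hv
  rw [h] at hv'
  exact hv'

end Pseudoforest

section Count

variable {n : ℕ} {G : SignedGraph (Fin n)}

-- When the flat contains a lattice point, the count is an index in the tower from the dilated
-- lattice through `G.lattice` to all lattice points of the span: the lower step contributes the
-- power of `t`, the upper one the power of two.
open Classical in
theorem IsPseudoforest.hitCount_eq (hG : G.IsPseudoforest) (t : ℕ) (ht : 0 < t)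
    (w : Fin n → ℝ) :
    hitCount (latticeCast (Fin n)) (AddSubgroup.closure ((fun e => t • cellVec e) '' G.cells))
      ({w} + (Submodule.span ℝ ((fun e => latticeCast (Fin n) (t • cellVec e)) '' G.cells) :
        Set (Fin n → ℝ))) =
    ((if ∃ x, latticeCast (Fin n) x - w ∈ G.realSpan then
      2 ^ (G.pc + G.lc) * t ^ (n - G.tc) else 0 : ℕ) : ℕ∞) := by
  have hspan : Submodule.span ℝ ((fun e => latticeCast (Fin n) (t • cellVec e)) '' G.cells) =
      G.realSpan := by
    have ht' : (t : ℝ) ≠ 0 := by exact_mod_cast ht.ne'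
    rw [realSpan]
    apply le_antisymm
    · rw [Submodule.span_le]
      rintro _ ⟨e, he, rfl⟩
      simp only [map_nsmul]
      exact Submodule.smul_of_tower_mem _ t (Submodule.subset_span ⟨e, he, rfl⟩)
    · rw [Submodule.span_le]
      rintro _ ⟨e, he, rfl⟩
      have h := Submodule.smul_mem (Submodule.span ℝ
        ((fun e => latticeCast (Fin n) (t • cellVec e)) '' G.cells)) (t : ℝ)⁻¹
        (Submodule.subset_span ⟨e, he, rfl⟩)
      beta_reduce at h
      rw [map_nsmul, ← Nat.cast_smul_eq_nsmul ℝ t, inv_smul_smul₀ ht'] at h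
      exact h
  have hindep : LinearIndepOn ℤ (cellVec : Cell (Fin n) → Fin n → ℤ) G.cells := by
    have h := (linearIndepOn_cells_iff.mpr hG).restrict_scalars' ℤ
    exact LinearIndependent.of_comp (latticeCast (Fin n)).toIntLinearMap h
  have hfin : G.cells.Finite := Set.toFinite _
  have hidx := relIndex_closure_nsmul cellVec hfin.toFinset (by simpa using hindep) t
  rw [hfin.coe_toFinset, ← Set.ncard_eq_toFinset_card _ hfin, hG.ncard_cells, Nat.card_fin] at hidx
  have hle : AddSubgroup.closure ((fun e => t • cellVec e) '' G.cells) ≤ G.lattice := by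
    rw [AddSubgroup.closure_le]
    rintro _ ⟨e, he, rfl⟩
    exact G.lattice.nsmul_mem (AddSubgroup.subset_closure ⟨e, he, rfl⟩) t
  have hmul := AddSubgroup.relIndex_mul_relIndex _ _
    (G.realSpan.toAddSubgroup.comap (latticeCast (Fin n))) hle
    (fun x hx => latticeCast_mem_realSpan hx)
  rw [relIndex_lattice, ← hG.pc_add_lc, lattice, hidx] at hmul
  have hmem : ∀ x, latticeCast (Fin n) x ∈ ({w} + (G.realSpan : Set (Fin n → ℝ))) ↔
      latticeCast (Fin n) x - w ∈ G.realSpan := by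
    intro x
    rw [Set.singleton_add, Set.mem_image]
    constructor
    · rintro ⟨z, hz, hzy⟩
      rw [← hzy, add_sub_cancel_left]
      exact hz
    · exact fun h => ⟨_, h, add_sub_cancel _ _⟩
  rw [hspan]
  split_ifs with h
  · obtain ⟨x, hx⟩ := h
    rw [hitCount_add_submodule _ ((hmem x).mpr hx), ← hmul, mul_comm]
    rw [← hmul]
    positivity
  · rw [hitCount_eq_zero, Nat.cast_zero]
    exact fun x hx => h ⟨x, (hmem x).mp hx⟩

end Count

end SignedGraph

/-! ### Signed graphs as sets of positive roots -/

namespace SignedGraph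

section FullGraph

variable {V : Type*}

/-- The largest signed graph of a given type. -/
def fullGraph (V : Type*) (Φ : ClassicalType) : SignedGraph V where
  pos := ⊤
  neg := match Φ with
    | .A => ⊥
    | _ => ⊤
  half := match Φ with
    | .B => Set.univ
    | _ => ∅
  loop := match Φ with
    | .C => Set.univ
    | _ => ∅

theorem mem_edges_iff_mem_edgeSet {G : SignedGraph V} {p : Sym2 V} {σ : ℤˣ} :
    (p, σ) ∈ G.edges ↔ (p ∈ G.pos.edgeSet ∧ σ = 1) ∨ (p ∈ G.neg.edgeSet ∧ σ = -1) := Iff.rfl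

theorem cells_subset_iff {G H : SignedGraph V} :
    G.cells ⊆ H.cells ↔ G.pos ≤ H.pos ∧ G.neg ≤ H.neg ∧ G.half ⊆ H.half ∧ G.loop ⊆ H.loop := by
  constructor
  · intro h
    refine ⟨fun i j hij => ?_, fun i j hij => ?_, fun v hv => ?_, fun v hv => ?_⟩
    · have h' : (s(i, j), 1) ∈ H.edges :=
        h (show Sum.inl (s(i, j), 1) ∈ G.cells from mem_edges_iff.mpr (Or.inl ⟨hij, rfl⟩))
      simpa [mem_edges_iff] using h'
    · have h' : (s(i, j), -1) ∈ H.edges :=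
        h (show Sum.inl (s(i, j), -1) ∈ G.cells from mem_edges_iff.mpr (Or.inr ⟨hij, rfl⟩))
      simpa [mem_edges_iff] using h'
    · exact h (show Sum.inr (Sum.inl v) ∈ G.cells from hv)
    · exact h (show Sum.inr (Sum.inr v) ∈ G.cells from hv)
  · rintro ⟨h1, h2, h3, h4⟩ (⟨p, σ⟩ | v | v) he
    · exact Or.imp (And.imp_left fun h => SimpleGraph.edgeSet_mono h1 h)
        (And.imp_left fun h => SimpleGraph.edgeSet_mono h2 h) he
    · exact h3 he
    · exact h4 he

theorem isGraphOfType_iff {G : SignedGraph V} {Φ : ClassicalType} :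
    G.IsGraphOfType Φ ↔ G.cells ⊆ (fullGraph V Φ).cells := by
  rw [cells_subset_iff]
  cases Φ <;> simp [IsGraphOfType, fullGraph]

theorem cells_injective : Function.Injective (cells : SignedGraph V → Set (Cell V)) := by
  intro G H h
  have h1 := cells_subset_iff.mp h.subset
  have h2 := cells_subset_iff.mp h.superset
  exact SignedGraph.ext (h1.1.antisymm h2.1) (h1.2.1.antisymm h2.2.1)
    (h1.2.2.1.antisymm h2.2.2.1) (h1.2.2.2.antisymm h2.2.2.2)

theorem not_isDiag_of_mem_cells {G : SignedGraph V} {p : Sym2 V} {σ : ℤˣ}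
    (h : Sum.inl (p, σ) ∈ G.cells) : ¬ p.IsDiag := by
  induction p using Sym2.ind with
  | _ i j => exact ne_of_mem_edges h

/-- Containment in the cells of some graph rules out diagonal pairs, which `SimpleGraph.fromEdgeSet`
would discard. -/
theorem exists_cells_eq {H : SignedGraph V} {S : Set (Cell V)} (hS : S ⊆ H.cells) :
    ∃ G : SignedGraph V, G.cells = S := by
  refine ⟨⟨.fromEdgeSet {p | .inl (p, 1) ∈ S}, .fromEdgeSet {p | .inl (p, -1) ∈ S},
    {v | .inr (.inl v) ∈ S}, {v | .inr (.inr v) ∈ S}⟩, ?_⟩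
  ext (⟨p, σ⟩ | v | v)
  · change ((p ∈ SimpleGraph.edgeSet _ ∧ σ = 1) ∨ (p ∈ SimpleGraph.edgeSet _ ∧ σ = -1)) ↔ _
    simp only [SimpleGraph.edgeSet_fromEdgeSet]
    constructor
    · rintro (⟨⟨h, -⟩, rfl⟩ | ⟨⟨h, -⟩, rfl⟩)
      · exact h
      · exact h
    · intro h
      have hd := not_isDiag_of_mem_cells (hS h)
      rcases Int.units_eq_one_or σ with rfl | rfl
      · exact Or.inl ⟨⟨h, hd⟩, rfl⟩
      · exact Or.inr ⟨⟨h, hd⟩, rfl⟩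
  · rfl
  · rfl

/-- Distinct cells give distinct vectors, so that a Minkowski sum over the set of roots is a sum
over cells. -/
theorem injOn_cellVec [LinearOrder V] (G : SignedGraph V) :
    Set.InjOn (cellVec : Cell V → V → ℤ) G.cells := by
  have key : ∀ {p : Sym2 V}, ¬ p.IsDiag → ∃ i j, i < j ∧ p = s(i, j) := by
    intro p
    induction p using Sym2.ind with
    | _ i j =>
      intro h
      rcases lt_or_gt_of_ne (show i ≠ j from h) with h | h
      · exact ⟨i, j, h, rfl⟩
      · exact ⟨j, i, h, Sym2.eq_swap⟩
  have hunit : ∀ σ : ℤˣ, (σ : ℤ) = 1 ∨ (σ : ℤ) = -1 := by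
    intro σ
    rcases Int.units_eq_one_or σ with rfl | rfl <;> simp
  have hedge : ∀ {i j k l : V} {σ τ : ℤˣ}, i < j → k < l →
      (Pi.single i 1 - Pi.single j (σ : ℤ) : V → ℤ) = Pi.single k 1 - Pi.single l (τ : ℤ) →
      i = k ∧ j = l ∧ σ = τ := by
    intro i j k l σ τ hij hkl h
    have hi := congrFun h i
    have hj := congrFun h j
    have hk := congrFun h k
    have hl := congrFun h l
    simp only [Pi.sub_apply, Pi.single_apply] at hi hj hk hl
    rcases hunit σ with hσ | hσ <;> rcases hunit τ with hτ | hτ <;>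
      simp only [hσ, hτ, Units.ext_iff] at hi hj hk hl ⊢ <;> grind
  have hone : ∀ {i j v : V} {σ : ℤˣ} {k : ℤ}, i < j →
      (Pi.single i 1 - Pi.single j (σ : ℤ) : V → ℤ) ≠ Pi.single v k := by
    intro i j v σ k hij h
    have hi := congrFun h i
    have hj := congrFun h j
    simp only [Pi.sub_apply, Pi.single_apply] at hi hj
    rcases hunit σ with hσ | hσ <;> simp only [hσ] at hi hj <;> grind
  have hsingle : ∀ {u v : V} {k l : ℤ}, k ≠ 0 → (Pi.single u k : V → ℤ) = Pi.single v l →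
      u = v ∧ k = l := by
    intro u v k l hk h
    have hu := congrFun h u
    simp only [Pi.single_apply] at hu
    grind
  rintro (⟨p, σ⟩ | v | v) he (⟨q, τ⟩ | w | w) hf h
  · obtain ⟨i, j, hij, rfl⟩ := key (not_isDiag_of_mem_cells he)
    obtain ⟨k, l, hkl, rfl⟩ := key (not_isDiag_of_mem_cells hf)
    rw [cellVec_mk_of_le hij.le, cellVec_mk_of_le hkl.le] at h
    obtain ⟨rfl, rfl, rfl⟩ := hedge hij hkl h
    rfl
  · obtain ⟨i, j, hij, rfl⟩ := key (not_isDiag_of_mem_cells he)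
    rw [cellVec_mk_of_le hij.le] at h
    exact absurd h (hone hij)
  · obtain ⟨i, j, hij, rfl⟩ := key (not_isDiag_of_mem_cells he)
    rw [cellVec_mk_of_le hij.le] at h
    exact absurd h (hone hij)
  · obtain ⟨i, j, hij, rfl⟩ := key (not_isDiag_of_mem_cells hf)
    rw [cellVec_mk_of_le hij.le] at h
    exact absurd h.symm (hone hij)
  · rw [(hsingle one_ne_zero h).1]
  · exact absurd (hsingle one_ne_zero h).2 (by norm_num)
  · obtain ⟨i, j, hij, rfl⟩ := key (not_isDiag_of_mem_cells hf)
    rw [cellVec_mk_of_le hij.le] at h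
    exact absurd h.symm (hone hij)
  · exact absurd (hsingle two_ne_zero h).2 (by norm_num)
  · rw [(hsingle two_ne_zero h).1]

end FullGraph

open Classical in
/-- The signed edges, halfedges and loops that encode the positive roots of a given type. -/
noncomputable def rootCells (Φ : ClassicalType) (n : ℕ) : Finset (Cell (Fin n)) :=
  (fullGraph (Fin n) Φ).cells.toFinset

theorem coe_rootCells (Φ : ClassicalType) (n : ℕ) :
    (rootCells Φ n : Set (Cell (Fin n))) = (fullGraph (Fin n) Φ).cells := by
  rw [rootCells, Set.coe_toFinset]

theorem mem_rootCells {Φ : ClassicalType} {n : ℕ} {e : Cell (Fin n)} :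
    e ∈ rootCells Φ n ↔ e ∈ (fullGraph (Fin n) Φ).cells := by
  rw [← coe_rootCells, Finset.mem_coe]

theorem latticeCast_injective (V : Type*) : Function.Injective (latticeCast V) := by
  intro x y h
  ext v
  have := congrFun h v
  simpa using this

theorem injOn_latticeCast_cellVec (Φ : ClassicalType) (n : ℕ) :
    Set.InjOn (fun e => latticeCast (Fin n) (cellVec e)) (rootCells Φ n) := by
  rw [coe_rootCells]
  exact (latticeCast_injective _).comp_injOn (injOn_cellVec _)

theorem latticeCast_single {n : ℕ} (v : Fin n) (k : ℤ) :
    latticeCast (Fin n) (Pi.single v k) = (k : ℝ) • stdVec v := by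
  ext w
  simp [stdVec, Pi.single_apply, apply_ite (Int.cast : ℤ → ℝ)]

theorem mem_rootsMinus {n : ℕ} {y : Fin n → ℝ} :
    y ∈ rootsMinus n ↔ ∃ p : Sym2 (Fin n), ¬ p.IsDiag ∧
      latticeCast (Fin n) (cellVec (.inl (p, 1))) = y := by
  simp only [rootsMinus, Finset.mem_image, Finset.mem_filter, Finset.mem_univ, true_and,
    Prod.exists]
  constructor
  · rintro ⟨i, j, hij, rfl⟩
    refine ⟨s(i, j), hij.ne, ?_⟩
    rw [cellVec_mk_of_le hij.le, map_sub, latticeCast_single, latticeCast_single]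
    simp
  · rintro ⟨p, hp, rfl⟩
    induction p using Sym2.ind with
    | _ i j =>
      have key : ∀ i j : Fin n, i < j → ∃ a b, a < b ∧
          stdVec a - stdVec b = latticeCast (Fin n) (cellVec (.inl (s(i, j), 1))) := by
        intro i j hij
        refine ⟨i, j, hij, ?_⟩
        rw [cellVec_mk_of_le hij.le, map_sub, latticeCast_single, latticeCast_single]
        simp
      rcases lt_or_gt_of_ne (show i ≠ j from hp) with h | h
      · exact key i j h
      · rw [Sym2.eq_swap]
        exact key j i h

theorem mem_rootsPlus {n : ℕ} {y : Fin n → ℝ} :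
    y ∈ rootsPlus n ↔ ∃ p : Sym2 (Fin n), ¬ p.IsDiag ∧
      latticeCast (Fin n) (cellVec (.inl (p, -1))) = y := by
  simp only [rootsPlus, Finset.mem_image, Finset.mem_filter, Finset.mem_univ, true_and,
    Prod.exists]
  constructor
  · rintro ⟨i, j, hij, rfl⟩
    refine ⟨s(i, j), hij.ne, ?_⟩
    rw [cellVec_mk_of_le hij.le, map_sub, latticeCast_single, latticeCast_single]
    simp
  · rintro ⟨p, hp, rfl⟩
    induction p using Sym2.ind with
    | _ i j =>
      have key : ∀ i j : Fin n, i < j → ∃ a b, a < b ∧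
          stdVec a + stdVec b = latticeCast (Fin n) (cellVec (.inl (s(i, j), -1))) := by
        intro i j hij
        refine ⟨i, j, hij, ?_⟩
        rw [cellVec_mk_of_le hij.le, map_sub, latticeCast_single, latticeCast_single]
        simp
      rcases lt_or_gt_of_ne (show i ≠ j from hp) with h | h
      · exact key i j h
      · rw [Sym2.eq_swap]
        exact key j i h

theorem mem_rootsShort {n : ℕ} {y : Fin n → ℝ} :
    y ∈ rootsShort n ↔ ∃ v, latticeCast (Fin n) (cellVec (.inr (.inl v))) = y := by
  simp [rootsShort, cellVec, latticeCast_single]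

theorem mem_rootsLong {n : ℕ} {y : Fin n → ℝ} :
    y ∈ rootsLong n ↔ ∃ v, latticeCast (Fin n) (cellVec (.inr (.inr v))) = y := by
  simp [rootsLong, cellVec, latticeCast_single]

theorem posRoots_eq_image (Φ : ClassicalType) (n : ℕ) :
    posRoots n Φ = (rootCells Φ n).image fun e => latticeCast (Fin n) (cellVec e) := by
  have hsign : (-1 : ℤˣ) ≠ 1 := by decide
  have hsign' : ∀ σ : ℤˣ, σ = 1 ∨ σ = -1 := Int.units_eq_one_or
  ext y
  simp only [Finset.mem_image, mem_rootCells, Sum.exists, Prod.exists, cells, Set.mem_ofPred_eq,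
    Sum.elim_inl, Sum.elim_inr, mem_edges_iff_mem_edgeSet]
  have hor : ∀ {P : Sym2 (Fin n) → Prop} {Q : Sym2 (Fin n) → Prop},
      (∃ p σ, ((P p ∧ σ = 1) ∨ (Q p ∧ σ = -1)) ∧
        latticeCast (Fin n) (cellVec (.inl (p, σ))) = y) ↔
      (∃ p, P p ∧ latticeCast (Fin n) (cellVec (.inl (p, 1))) = y) ∨
        ∃ p, Q p ∧ latticeCast (Fin n) (cellVec (.inl (p, -1))) = y := by
    intro P Q
    constructor
    · rintro ⟨p, σ, ⟨h, rfl⟩ | ⟨h, rfl⟩, h'⟩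
      · exact Or.inl ⟨p, h, h'⟩
      · exact Or.inr ⟨p, h, h'⟩
    · rintro (⟨p, h, h'⟩ | ⟨p, h, h'⟩)
      · exact ⟨p, 1, Or.inl ⟨h, rfl⟩, h'⟩
      · exact ⟨p, -1, Or.inr ⟨h, rfl⟩, h'⟩
  rw [hor]
  cases Φ <;> simp [posRoots, fullGraph, mem_rootsMinus, mem_rootsPlus, mem_rootsShort,
    mem_rootsLong, or_assoc]

open Classical in
/-- Linearly independent sets of positive roots correspond to forests. -/
theorem sum_powerset_rootCells {M : Type*} [AddCommMonoid M] (Φ : ClassicalType) (n : ℕ)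
    (f : Set (Cell (Fin n)) → M) :
    (∑ S ∈ (rootCells Φ n).powerset,
      if LinearIndepOn ℝ (fun e => latticeCast (Fin n) (cellVec e)) (S : Set (Cell (Fin n))) then
        f S else 0) = ∑ G ∈ forests Φ n, f G.cells := by
  rw [← Finset.sum_filter]
  symm
  refine Finset.sum_bij (fun G _ => G.cells.toFinset) ?_ ?_ ?_ ?_
  · intro G hG
    rw [forests, Finset.mem_filter] at hG
    rw [Finset.mem_filter, Finset.mem_powerset, ← Finset.coe_subset, Set.coe_toFinset,
      coe_rootCells]
    exact ⟨isGraphOfType_iff.mp hG.2.1, linearIndepOn_cells_iff.mpr hG.2.2⟩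
  · intro G _ H _ h
    exact cells_injective (Set.toFinset_inj.mp h)
  · intro S hS
    rw [Finset.mem_filter, Finset.mem_powerset, ← Finset.coe_subset, coe_rootCells] at hS
    obtain ⟨G, hG⟩ := exists_cells_eq hS.1
    refine ⟨G, ?_, ?_⟩
    · rw [forests, Finset.mem_filter, isGraphOfType_iff, ← linearIndepOn_cells_iff, hG]
      exact ⟨Finset.mem_univ _, hS⟩
    · ext e
      rw [Set.mem_toFinset, hG, Finset.mem_coe]
  · intro G _
    rw [Set.coe_toFinset]

end SignedGraph

/-! ### Counting lattice points of Coxeter permutahedra -/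

open SignedGraph

theorem smul_segment_eq {n : ℕ} (t : ℝ) (a b : Fin n → ℝ) :
    t • segment ℝ a b = segment ℝ (t • a) (t • b) := by
  have h := image_segment ℝ (LinearMap.lsmul ℝ (Fin n → ℝ) t).toAffineMap a b
  exact h

theorem Finset.sum_singleton_add {ι M : Type*} [AddCommMonoid M] (R : Finset ι) (a : ι → M)
    (s : ι → Set M) : ∑ i ∈ R, ({a i} + s i) = {∑ i ∈ R, a i} + ∑ i ∈ R, s i := by
  classical
  induction R using Finset.induction_on with
  | empty => simp [Set.singleton_zero]
  | insert i R hi ih =>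
    rw [Finset.sum_insert hi, Finset.sum_insert hi, Finset.sum_insert hi, ih,
      ← Set.singleton_add_singleton, add_add_add_comm]

theorem smul_integralPermutahedron (Φ : ClassicalType) (n t : ℕ) :
    (t : ℝ) • integralPermutahedron Φ n =
      ∑ e ∈ rootCells Φ n, segment ℝ 0 (latticeCast (Fin n) (t • cellVec e)) := by
  rw [integralPermutahedron, posRoots_eq_image, Finset.sum_image (injOn_latticeCast_cellVec Φ n),
    Finset.smul_sum]
  refine Finset.sum_congr rfl fun e _ => ?_
  rw [smul_segment_eq, smul_zero, map_nsmul, Nat.cast_smul_eq_nsmul]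

/-- The sum of the positive roots. -/
noncomputable def rootSum (Φ : ClassicalType) (n : ℕ) : Fin n → ℤ :=
  ∑ e ∈ rootCells Φ n, cellVec e

/-- Each segment `[-α/2, α/2]` is `[0, α]` translated by `-α/2`. -/
theorem standardPermutahedron_eq (Φ : ClassicalType) (n : ℕ) :
    standardPermutahedron Φ n =
      {-((1 / 2 : ℝ) • latticeCast (Fin n) (rootSum Φ n))} + integralPermutahedron Φ n := by
  have h : ∀ α : Fin n → ℝ, segment ℝ (-((1 / 2 : ℝ) • α)) ((1 / 2 : ℝ) • α) =
      {-((1 / 2 : ℝ) • α)} + segment ℝ 0 α := by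
    intro α
    rw [Set.singleton_add, segment_translate_image, add_zero]
    congr 1
    module
  simp only [standardPermutahedron, integralPermutahedron, h]
  rw [Finset.sum_singleton_add, Finset.sum_neg_distrib, ← Finset.smul_sum, posRoots_eq_image,
    Finset.sum_image (injOn_latticeCast_cellVec Φ n), rootSum, map_sum]

theorem smul_standardPermutahedron (Φ : ClassicalType) (n t : ℕ) :
    (t : ℝ) • standardPermutahedron Φ n =
      {-((t / 2 : ℝ) • latticeCast (Fin n) (rootSum Φ n))} +
        ∑ e ∈ rootCells Φ n, segment ℝ 0 (latticeCast (Fin n) (t • cellVec e)) := by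
  rw [standardPermutahedron_eq, smul_add, smul_integralPermutahedron, Set.smul_set_singleton,
    smul_neg, smul_smul, mul_one_div]

theorem ehr_eq_encard {n : ℕ} (P : Set (Fin n → ℝ)) (t : ℕ) :
    ehr P t = (latticeCast (Fin n) ⁻¹' ((t : ℝ) • P)).encard := by
  rw [ehr, ← (latticeCast_injective (Fin n)).encard_image]
  congr 1
  ext x
  constructor
  · rintro ⟨hx, hz⟩
    choose z hz using hz
    have h : latticeCast (Fin n) z = x := funext fun i => (hz i).symm
    exact ⟨z, by rwa [Set.mem_preimage, h], h⟩
  · rintro ⟨z, hz, rfl⟩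
    exact ⟨hz, fun i => ⟨z i, rfl⟩⟩

open Classical in
/-- The number of lattice points of a translate of a dilated integral Coxeter permutahedron. -/
theorem encard_translate (Φ : ClassicalType) (n t : ℕ) (ht : 0 < t) (w : Fin n → ℝ) :
    (latticeCast (Fin n) ⁻¹' ({w} +
      ∑ e ∈ rootCells Φ n, segment ℝ 0 (latticeCast (Fin n) (t • cellVec e)))).encard =
    ((∑ G ∈ forests Φ n, if ∃ x, latticeCast (Fin n) x - w ∈ G.realSpan then
      2 ^ (G.pc + G.lc) * t ^ (n - G.tc) else 0 : ℕ) : ℕ∞) := by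
  have hiff : ∀ S : Finset (Cell (Fin n)),
      LinearIndepOn ℝ (fun e => latticeCast (Fin n) (t • cellVec e)) (S : Set (Cell (Fin n))) ↔
      LinearIndepOn ℝ (fun e => latticeCast (Fin n) (cellVec e)) (S : Set (Cell (Fin n))) := by
    intro S
    have ht' : (t : ℝ) ≠ 0 := by exact_mod_cast ht.ne'
    simp only [map_nsmul, ← Nat.cast_smul_eq_nsmul ℝ t]
    refine ⟨fun h => ?_, fun h => h.units_smul fun _ => Units.mk0 (t : ℝ) ht'⟩
    have h' : LinearIndependent ℝ fun e : (S : Set (Cell (Fin n))) =>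
        (t : ℝ)⁻¹ • (t : ℝ) • latticeCast (Fin n) (cellVec (e : Cell (Fin n))) :=
      h.units_smul fun _ => (Units.mk0 (t : ℝ) ht')⁻¹
    simp only [inv_smul_smul₀ ht'] at h'
    exact h'
  rw [encard_preimage_zonotope (latticeCast (Fin n)) (fun e => t • cellVec e) w (rootCells Φ n)]
  simp only [hiff]
  rw [sum_powerset_rootCells Φ n fun S =>
    hitCount (latticeCast (Fin n)) (AddSubgroup.closure ((fun e => t • cellVec e) '' S))
      ({w} + (Submodule.span ℝ ((fun e => latticeCast (Fin n) (t • cellVec e)) '' S) :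
        Set (Fin n → ℝ))), Nat.cast_sum]
  refine Finset.sum_congr rfl fun G hG => ?_
  rw [forests, Finset.mem_filter] at hG
  exact hG.2.2.hitCount_eq t ht w

theorem encard_translate_latticeCast (Φ : ClassicalType) (n t : ℕ) (ht : 0 < t) (x : Fin n → ℤ) :
    (latticeCast (Fin n) ⁻¹' ({latticeCast (Fin n) x} +
      ∑ e ∈ rootCells Φ n, segment ℝ 0 (latticeCast (Fin n) (t • cellVec e)))).encard =
    ((∑ G ∈ forests Φ n, 2 ^ (G.pc + G.lc) * t ^ (n - G.tc) : ℕ) : ℕ∞) := by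
  classical
  rw [encard_translate Φ n t ht]
  congr 1
  refine Finset.sum_congr rfl fun G _ => if_pos ⟨x, ?_⟩
  rw [sub_self]
  exact zero_mem _

theorem ehr_integralPermutahedron (Φ : ClassicalType) (n t : ℕ) (ht : 0 < t) :
    ehr (integralPermutahedron Φ n) t =
      ((∑ G ∈ forests Φ n, 2 ^ (G.pc + G.lc) * t ^ (n - G.tc) : ℕ) : ℕ∞) := by
  rw [ehr_eq_encard, smul_integralPermutahedron, ← encard_translate_latticeCast Φ n t ht 0,
    map_zero, Set.singleton_zero, zero_add]

theorem ehr_standardPermutahedron_of_even (Φ : ClassicalType) (n t : ℕ) (ht : 0 < t)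
    (h : ∀ v, Even (t * rootSum Φ n v)) :
    ehr (standardPermutahedron Φ n) t =
      ((∑ G ∈ forests Φ n, 2 ^ (G.pc + G.lc) * t ^ (n - G.tc) : ℕ) : ℕ∞) := by
  choose k hk using h
  rw [ehr_eq_encard, smul_standardPermutahedron, ← encard_translate_latticeCast Φ n t ht (-k)]
  congr 5
  ext v
  have h' : (t : ℝ) * (rootSum Φ n v : ℝ) = k v + k v := by exact_mod_cast hk v
  simp only [Pi.neg_apply, Pi.smul_apply, latticeCast_apply, smul_eq_mul, Int.cast_neg]
  linarith

theorem ehr_standardPermutahedron_of_odd (Φ : ClassicalType) (n t : ℕ) (ht : 0 < t)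
    (h : ∀ v, Odd (t * rootSum Φ n v)) :
    ehr (standardPermutahedron Φ n) t =
      ((∑ G ∈ evenForests Φ n, 2 ^ (G.pc + G.lc) * t ^ (n - G.tc) : ℕ) : ℕ∞) := by
  classical
  choose k hk using h
  rw [ehr_eq_encard, smul_standardPermutahedron, encard_translate Φ n t ht, evenForests,
    Finset.sum_filter]
  congr 1
  refine Finset.sum_congr rfl fun G hG => ?_
  rw [forests, Finset.mem_filter] at hG
  -- With `t` times the root sum equal to `2k + 1`, the translation is `-(2k + 1)/2 = (-k - 1) +
  -- 1/2`.
  rw [exists_latticeCast_sub_mem_realSpan_iff (k := fun v => -k v - 1)]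
  · simp only [hG.2.2.component_isTree_iff]
    congr
  · intro v
    have h' : (t : ℝ) * (rootSum Φ n v : ℝ) = 2 * k v + 1 := by exact_mod_cast hk v
    simp only [Pi.neg_apply, Pi.smul_apply, latticeCast_apply, smul_eq_mul, Int.cast_neg,
      Int.cast_sub, Int.cast_one]
    linarith

/-! ### Parity of the sum of the positive roots -/

open Classical in
theorem cellVec_zmod_two {V : Type*} [LinearOrder V] {p : Sym2 V} (hp : ¬ p.IsDiag)
    (σ : ℤˣ) (v : V) :
    (cellVec (.inl (p, σ)) v : ZMod 2) = if v ∈ p then 1 else 0 := by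
  have hσ : ((σ : ℤ) : ZMod 2) = 1 := by
    rcases Int.units_eq_one_or σ with rfl | rfl <;> decide
  have h2 : (-1 : ZMod 2) = 1 := by decide
  induction p using Sym2.ind with
  | _ i j =>
    have hij : i ≠ j := hp
    have key : ∀ {i j : V}, i < j → (cellVec (.inl (s(i, j), σ)) v : ZMod 2) =
        if v = i ∨ v = j then 1 else 0 := by
      intro i j hij
      rw [cellVec_mk_of_le hij.le]
      simp only [Pi.sub_apply, Pi.single_apply, Int.cast_sub, apply_ite (Int.cast : ℤ → ZMod 2),
        hσ, Int.cast_one, Int.cast_zero]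
      by_cases h1 : v = i
      · subst h1
        simp [hij.ne]
      · by_cases h2 : v = j
        · subst h2
          simp [h1, h2]
        · simp [h1, h2]
    simp only [Sym2.mem_iff]
    rcases lt_or_gt_of_ne hij with h | h
    · exact key h
    · rw [Sym2.eq_swap, key h]
      simp only [or_comm]

open Classical in
theorem ncard_neighborSet_zmod_two {V : Type*} [Fintype V] (H : SimpleGraph V) (v : V) :
    ((H.neighborSet v).ncard : ZMod 2) =
      ∑ p : Sym2 V, if p ∈ H.edgeSet then (if v ∈ p then 1 else 0) else 0 := by
  rw [Set.ncard_eq_toFinset_card', ← SimpleGraph.neighborFinset_def,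
    SimpleGraph.card_neighborFinset_eq_degree, ← SimpleGraph.card_incidenceFinset_eq_degree, SimpleGraph.incidenceFinset_eq_filter,
    ← Finset.sum_boole]
  refine Eq.trans ?_ (Finset.sum_filter (fun p => p ∈ H.edgeSet) _)
  exact Finset.sum_congr (by ext p; simp) fun _ _ => rfl

-- Modulo two an edge of either sign contributes `1` at both ends, a halfedge contributes `1` and a
-- loop `2 = 0`, so the sum is a vertex degree.
open Classical in
theorem sum_cellVec_zmod_two {V : Type*} [Fintype V] [LinearOrder V] (G : SignedGraph V) (v : V) :
    ((∑ e ∈ G.cells.toFinset, cellVec e v : ℤ) : ZMod 2) =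
      (G.pos.neighborSet v).ncard + (G.neg.neighborSet v).ncard + if v ∈ G.half then 1 else 0 := by
  have huniv : (Finset.univ : Finset ℤˣ) = {1, -1} := by decide
  have hsign : (1 : ℤˣ) ≠ -1 := by decide
  have h1 : G.cells.toFinset = Finset.univ.filter (· ∈ G.cells) := by
    ext e
    simp
  have hedge : ∀ (H : SimpleGraph V) (p : Sym2 V) (σ : ℤˣ),
      (if p ∈ H.edgeSet then (cellVec (.inl (p, σ)) v : ZMod 2) else 0) =
        if p ∈ H.edgeSet then (if v ∈ p then 1 else 0) else 0 := by
    intro H p σ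
    split_ifs with hp hv
    · rw [cellVec_zmod_two (H.not_isDiag_of_mem_edgeSet hp), if_pos hv]
    · rw [cellVec_zmod_two (H.not_isDiag_of_mem_edgeSet hp), if_neg hv]
    · rfl
  rw [h1, Int.cast_sum, Finset.sum_filter, Fintype.sum_sum_type, Fintype.sum_sum_type,
    Fintype.sum_prod_type, ncard_neighborSet_zmod_two, ncard_neighborSet_zmod_two]
  congr 1
  · rw [← Finset.sum_add_distrib]
    refine Finset.sum_congr rfl fun p _ => ?_
    rw [huniv, Finset.sum_pair hsign]
    refine congrArg₂ (· + ·) ?_ ?_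
    · convert hedge G.pos p 1 using 2
      · simp [cells, mem_edges_iff_mem_edgeSet, hsign]
      · congr
    · convert hedge G.neg p (-1) using 2
      · simp [cells, mem_edges_iff_mem_edgeSet, hsign.symm]
      · congr
  · have h2 : (2 : ZMod 2) = 0 := by decide
    rw [← Finset.sum_add_distrib, Finset.sum_eq_single v (fun w _ hw => by simp [cellVec, hw.symm]) (by simp)]
    simp [cells, cellVec, h2]

/-- The parity of the coordinates of the sum of the positive roots. -/
theorem rootSum_zmod_two (Φ : ClassicalType) (n : ℕ) (v : Fin n) :
    (rootSum Φ n v : ZMod 2) = match Φ with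
      | .A => ((n - 1 : ℕ) : ZMod 2)
      | .B => 1
      | _ => 0 := by
  classical
  rw [rootSum, Finset.sum_apply, rootCells]
  have h := sum_cellVec_zmod_two (fullGraph (Fin n) Φ) v
  have h2 : ∀ x : ZMod 2, x + x = 0 := by decide
  have htop : ((⊤ : SimpleGraph (Fin n)).neighborSet v).ncard = n - 1 := by
    rw [SimpleGraph.neighborSet_top, Set.ncard_compl, Set.ncard_singleton, Nat.card_fin]
  have hbot : ((⊥ : SimpleGraph (Fin n)).neighborSet v).ncard = 0 := by
    rw [SimpleGraph.neighborSet_bot, Set.ncard_empty]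
  refine Eq.trans (congrArg _ (Finset.sum_congr (by ext e; simp) fun _ _ => rfl)) (h.trans ?_)
  -- Outside type `A` the positive and negative degrees are both `n - 1` and cancel modulo two.
  cases Φ <;> simp [fullGraph, htop, h2, -SimpleGraph.neighborSet_top]

theorem even_mul_rootSum {Φ : ClassicalType} {n t : ℕ}
    (h : Even t ∨ (Φ = .A ∧ Odd n) ∨ Φ = .C ∨ Φ = .D) (v : Fin n) : Even (t * rootSum Φ n v) := by
  have hz : ∀ x : ℤ, (x : ZMod 2) = 0 → Even x := fun x hx =>
    even_iff_two_dvd.mpr ((ZMod.intCast_zmod_eq_zero_iff_dvd x 2).mp hx)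
  rcases h with h | ⟨rfl, h⟩ | rfl | rfl
  · exact ((Int.even_coe_nat t).mpr h).mul_right _
  · refine (hz _ ?_).mul_left _
    rw [rootSum_zmod_two]
    exact (ZMod.natCast_eq_zero_iff_even).mpr (Nat.Odd.sub_odd h odd_one)
  · exact (hz _ (rootSum_zmod_two .C n v)).mul_left _
  · exact (hz _ (rootSum_zmod_two .D n v)).mul_left _

theorem odd_mul_rootSum {Φ : ClassicalType} {n t : ℕ} (ht : Odd t) (hn : 1 ≤ n)
    (h : (Φ = .A ∧ Even n) ∨ Φ = .B) (v : Fin n) : Odd (t * rootSum Φ n v) := by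
  have hz : ∀ x : ℤ, (x : ZMod 2) = 1 → Odd x := by
    intro x hx
    rw [← Int.not_even_iff_odd, even_iff_two_dvd]
    intro h
    rw [(ZMod.intCast_zmod_eq_zero_iff_dvd x 2).mpr h] at hx
    exact absurd hx (by decide)
  refine ((Int.odd_coe_nat t).mpr ht).mul (hz _ ?_)
  rw [rootSum_zmod_two]
  rcases h with ⟨rfl, h⟩ | rfl
  · exact (ZMod.natCast_eq_one_iff_odd).mpr (Nat.Even.sub_odd hn h odd_one)
  · rfl

theorem lc_eq_zero_of_mem_forests {Φ : ClassicalType} {n : ℕ} (h : Φ = .A ∨ Φ = .B)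
    {G : SignedGraph (Fin n)} (hG : G ∈ forests Φ n) : G.lc = 0 := by
  classical
  rw [forests, Finset.mem_filter] at hG
  refine lc_eq_zero ?_
  rcases h with rfl | rfl
  · exact hG.2.1.2.2
  · exact hG.2.1

theorem evenForests_subset (Φ : ClassicalType) (n : ℕ) : evenForests Φ n ⊆ forests Φ n := by
  classical
  exact Finset.filter_subset _ _

/-! ### Minimality of the period and the theorem -/

open Polynomial in
/-- The polynomials for even and for odd dilations differ: only the first has a nonzero constant
coefficient. -/
theorem sum_forests_ne_sum_evenForests (Φ : ClassicalType) (n : ℕ) (hn : 1 ≤ n) :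
    (∑ G ∈ forests Φ n, C ((2 : ℚ) ^ G.pc) * X ^ (n - G.tc) : Polynomial ℚ) ≠
      ∑ G ∈ evenForests Φ n, C ((2 : ℚ) ^ G.pc) * X ^ (n - G.tc) := by
  classical
  intro h
  have heval := congrArg (eval 0) h
  simp only [eval_finsetSum, eval_mul, eval_C, eval_pow, eval_X] at heval
  have hforest : ∀ {G}, G ∈ forests Φ n → G.IsPseudoforest ∧ G.cells.ncard = n - G.tc := by
    intro G hG
    rw [forests, Finset.mem_filter] at hG
    exact ⟨hG.2.2, by simpa using hG.2.2.ncard_cells⟩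
  -- A term survives at zero only if the forest has no cells; its components are then single
  -- vertices, which are trees of odd order.
  have hzero : ∑ G ∈ evenForests Φ n, (2 : ℚ) ^ G.pc * 0 ^ (n - G.tc) = 0 := by
    refine Finset.sum_eq_zero fun G hG => ?_
    obtain ⟨hp, hcells⟩ := hforest (evenForests_subset Φ n hG)
    rw [zero_pow, mul_zero]
    intro h0
    rw [h0, Set.ncard_eq_zero (Set.toFinite _)] at hcells
    rw [evenForests, Finset.mem_filter] at hG
    let v : Fin n := ⟨0, hn⟩
    have hadj : ∀ i j, ¬ G.underlying.Adj i j := by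
      intro i j hij
      obtain ⟨σ, hσ⟩ := underlying_adj_iff.mp hij
      exact (Set.eq_empty_iff_forall_notMem.mp hcells) (.inl (s(i, j), σ)) hσ
    have hsupp : (G.underlying.connectedComponentMk v).supp = {v} := by
      ext w
      rw [SimpleGraph.ConnectedComponent.mem_supp_iff, SimpleGraph.ConnectedComponent.eq,
        Set.mem_singleton_iff]
      constructor
      · rintro ⟨p⟩
        cases p with
        | nil => rfl
        | cons h _ => exact absurd h (hadj _ _)
      · rintro rfl
        rfl
    have heven := hG.2 (G.underlying.connectedComponentMk v) (by
      rw [hp.component_isTree_iff, component_balanced_iff]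
      refine ⟨⟨1, fun i _ j σ hσ => absurd (underlying_adj_iff.mpr ⟨σ, hσ⟩) (hadj i j)⟩,
        fun u _ => ⟨fun hu => ?_, fun hu => ?_⟩⟩
      · exact (Set.eq_empty_iff_forall_notMem.mp hcells) (.inr (.inl u)) hu
      · exact (Set.eq_empty_iff_forall_notMem.mp hcells) (.inr (.inr u)) hu)
    rw [hsupp, Set.ncard_singleton] at heven
    exact absurd heven (by decide)
  -- The empty graph is a forest and contributes a positive constant term.
  obtain ⟨G, hG⟩ := exists_cells_eq (Set.empty_subset (fullGraph (Fin n) Φ).cells)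
  have hGmem : G ∈ forests Φ n := by
    rw [forests, Finset.mem_filter, isGraphOfType_iff, ← linearIndepOn_cells_iff, hG]
    exact ⟨Finset.mem_univ _, Set.empty_subset _, linearIndepOn_empty _ _⟩
  have htc := (hforest hGmem).2
  rw [hG, Set.ncard_empty] at htc
  have hpos : 0 < ∑ G ∈ forests Φ n, (2 : ℚ) ^ G.pc * 0 ^ (n - G.tc) := by
    refine Finset.sum_pos' (fun H _ => by positivity) ⟨G, hGmem, ?_⟩
    rw [← htc, pow_zero, mul_one]
    positivity
  rw [heval, hzero] at hpos
  exact lt_irrefl _ hpos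

open Polynomial in
theorem theorem4p3 (n : ℕ) (hn : 1 ≤ n) :
    -- the integral Coxeter permutahedra
    (∀ Φ : ClassicalType,
      IsEhrhartPolynomial (integralPermutahedron Φ n)
        (∑ G ∈ forests Φ n, C ((2 : ℚ) ^ (G.pc + G.lc)) * X ^ (n - G.tc))) ∧
    -- the standard Coxeter permutahedra of `A_{n-1}`, `n` even, and of `B_n`
    (∀ Φ : ClassicalType, (Φ = .A ∧ Even n) ∨ Φ = .B →
      IsEhrhartQuasipolynomial (standardPermutahedron Φ n) 2
        (fun t : ℤ =>
          if Even t then ∑ G ∈ forests Φ n, C ((2 : ℚ) ^ G.pc) * X ^ (n - G.tc)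
          else ∑ G ∈ evenForests Φ n, C ((2 : ℚ) ^ G.pc) * X ^ (n - G.tc))) ∧
    -- the standard Coxeter permutahedra of `A_{n-1}`, `n` odd, of `C_n` and of `D_n`
    (∀ Φ : ClassicalType, (Φ = .A ∧ Odd n) ∨ Φ = .C ∨ Φ = .D →
      ∀ t : ℕ, 0 < t →
        ehr (standardPermutahedron Φ n) t = ehr (integralPermutahedron Φ n) t) := by
  refine ⟨fun Φ t ht => ⟨_, ehr_integralPermutahedron Φ n t ht, ?_⟩, fun Φ hΦ => ⟨⟨⟨two_pos, ?_⟩,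
    ?_⟩, fun t ht => ?_⟩, fun Φ hΦ t ht => ?_⟩
  · simp [eval_finsetSum]
  · intro t
    simp
  · rintro r ⟨hr, hper⟩
    by_contra hlt
    obtain rfl : r = 1 := by omega
    -- Period one would identify the polynomials at `0` and `1`, which are those for even and odd
    -- dilations.
    have h := hper 0
    simp only [Nat.cast_one, zero_add, Int.not_even_one, if_false, Even.zero, if_true] at h
    exact sum_forests_ne_sum_evenForests Φ n hn h.symm
  · have hAB : Φ = .A ∨ Φ = .B := hΦ.imp_left And.left
    rcases Nat.even_or_odd t with h | h
    · refine ⟨_, ehr_standardPermutahedron_of_even Φ n t ht (even_mul_rootSum (Or.inl h)), ?_⟩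
      have h' : Even (t : ℤ) := (Int.even_coe_nat t).mpr h
      simp only [if_pos h', eval_finsetSum, Nat.cast_sum]
      refine Finset.sum_congr rfl fun G hG => ?_
      -- Types `A` and `B` have no loops, so `lc` drops out of the exponent.
      simp [lc_eq_zero_of_mem_forests hAB hG]
    · refine ⟨_, ehr_standardPermutahedron_of_odd Φ n t ht (odd_mul_rootSum h hn hΦ), ?_⟩
      have h' : ¬ Even (t : ℤ) := by
        rw [Int.even_coe_nat]
        exact Nat.not_even_iff_odd.mpr h
      simp only [if_neg h', eval_finsetSum, Nat.cast_sum]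
      refine Finset.sum_congr rfl fun G hG => ?_
      simp [lc_eq_zero_of_mem_forests hAB (evenForests_subset Φ n hG)]
  · rw [ehr_integralPermutahedron Φ n t ht,
      ehr_standardPermutahedron_of_even Φ n t ht (even_mul_rootSum (Or.inr hΦ))]
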